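/- **Setting.** Let $F$ be Thompson's group: the homeomorphisms $g$ of $[0,1]$ that map the intervals of some standard dyadic partition affinely, in order, onto the intervals of another one. Standard dyadic partitions correspond to finite rooted planar binary trees. A pair of trees $(T_+,T_-)$ with the same number of leaves *represents* $g$ if $g$ maps the $i$-th interval of the partition of $T_-$ affinely onto the $i$-th interval of that of $T_+$, for every $i$. Consider Temperley–Lieb diagrams with loop value $\delta=\sqrt3$ and complex coefficients. Let $f=\mathrm{id}-\delta^{-1}\,\cup\cap$ be the second Jones–Wenzl idempotent; a *cable* is a pair of strings with $f$ on it. Let $P_n$ be the space of diagrams with one input cable and $n$ output cables, with $\langle x,y\rangle$ the scalar such that $x^*y=\langle x,y\rangle f$, where $x^*$ is the mirror image. Let $S\in P_2$ be the trivalent vertex $3^{1/4}\,(f\otimes f)(1\otimes\cup\otimes 1)f$, which satisfies $S^*S=f$. For a standard dyadic partition $\mathcal I$ with $n$ intervals put $\mathcal H(\mathcal I)=P_n$; for a refinement $\mathcal J$ of $\mathcal I$ let $\mathcal H(\mathcal I)\to\mathcal H(\mathcal J)$ compose with the forest that refines $\mathcal I$ to $\mathcal J$, every vertex of it being replaced by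 $S$. These maps are isometric; let $\mathcal H$ be the (Hausdorff) completion of the direct limit. For $g\in F$ and $v\in\mathcal H(\mathcal J)$, where $\mathcal J$ and $g(\mathcal J)$ are standard dyadic partitions and $g$ is affine on every interval of $\mathcal J$, let $\pi(g)v$ be the same diagram $v$ in $\mathcal H(g(\mathcal J))$. This defines a unitary representation $\pi$ of $F$ on $\mathcal H$. Let $\xi\in\mathcal H(\{[0,1]\})$ be the vacuum vector, one straight cable. The *3-colorable subgroup* is $$\mathcal F=\{g\in F:\ \pi(g)\xi=\xi\}.$$ For trees $T_\pm$ with $n$ leaves, put $T_+$ in the upper and the reflected $T_-$ in the lower half plane and glue the leaves. $\Gamma(T_+,T_-)$ is the dual graph: its vertices are the regions $0,1,\dots,n$ from left to right, and two regions are adjacent if an edge of $T_+$ or of $T_-$ separates them (each tree has a root edge, which separates $0$ and $n$). Let $X$ be the tree with four leaves, all of depth two, and $\mathrm{Alg}(X)$ the set of trees obtained from the one-leaf tree by repeatedly attaching a copy of $X$ to a leaf. For $N\ge2$ let $F_N=\langle x_0,x_1,x_2,\dots\mid x_k^{-1}x_nx_k=x_{n+N-1},\ k<n\rangle$. **Theorem.**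 1. $\mathcal F$ is isomorphic to $F_4$. 2. If $g\in F$ is represented by the pair of trees $(T_+,T_-)$, then $g\in\mathcal F$ if and only if $\Gamma(T_+,T_-)$ is 3-colorable. 3. An element $g\in F$ lies in $\mathcal F$ if and only if it is represented by some pair $(T_+,T_-)$ with $T_+,T_-\in\mathrm{Alg}(X)$. -/

import Mathlib

namespace ThreeColor

/-- Finite rooted planar binary trees. -/
inductive BTree : Type
  | leaf : BTree
  | node : BTree → BTree → BTree

namespace BTree

/-- The number of leaves. -/
def leaves : BTree → ℕ
  | leaf => 1
  | node l r => l.leaves + r.leaves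

/-- The standard dyadic partition of `[a, b]` cut out by a tree: the list, from left to right, of
the pairs (left end, right end) of its intervals.  A caret halves an interval. -/
noncomputable def intervals : BTree → ℝ → ℝ → List (ℝ × ℝ)
  | leaf, a, b => [(a, b)]
  | node l r, a, b => l.intervals a ((a + b) / 2) ++ r.intervals ((a + b) / 2) b

/-- `t.le s`: the partition of `s` refines that of `t`. -/
def le : BTree → BTree → Prop
  | leaf, _ => True
  | node _ _, leaf => False
  | node l r, node l' r' => l.le l' ∧ r.le r'

theorem le_refl' : ∀ t : BTree, t.le t
  | leaf => trivial
  | node l r => ⟨le_refl' l, le_refl' r⟩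

theorem le_trans' : ∀ t s u : BTree, t.le s → s.le u → t.le u
  | leaf, _, _, _, _ => trivial
  | node _ _, leaf, _, h, _ => h.elim
  | node _ _, node _ _, leaf, _, h => h.elim
  | node l r, node l' r', node l'' r'', h, h' =>
    ⟨le_trans' l l' l'' h.1 h'.1, le_trans' r r' r'' h.2 h'.2⟩

/-- Trees, that is standard dyadic partitions, ordered by refinement. -/
instance : Preorder BTree where
  le := le
  le_refl := le_refl'
  le_trans := le_trans'

theorem leaf_le (t : BTree) : leaf ≤ t := trivial

theorem not_node_le_leaf {l r : BTree} : ¬ node l r ≤ leaf := fun h => h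

theorem node_le_node {l r l' r' : BTree} : node l r ≤ node l' r' ↔ l ≤ l' ∧ r ≤ r' := Iff.rfl

/-- The coarsest common refinement. -/
def join : BTree → BTree → BTree
  | leaf, s => s
  | t, leaf => t
  | node l r, node l' r' => node (l.join l') (r.join r')

theorem le_join : ∀ t s : BTree, t ≤ t.join s ∧ s ≤ t.join s
  | leaf, s => ⟨leaf_le _, by simp [join]⟩
  | node l r, leaf => ⟨by simp [join], leaf_le _⟩
  | node l r, node l' r' => by
    simp only [join, node_le_node]
    exact ⟨⟨(le_join l l').1, (le_join r r').1⟩, ⟨(le_join l l').2, (le_join r r').2⟩⟩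

instance : Nonempty BTree := ⟨leaf⟩

instance : IsDirectedOrder BTree := ⟨fun t s => ⟨t.join s, le_join t s⟩⟩

/-- For `t ≤ s`, the forest whose trees, put on the leaves of `t`, give `s`. -/
def forest : BTree → BTree → List BTree
  | leaf, s => [s]
  | node _ _, leaf => []
  | node l r, node l' r' => l.forest l' ++ r.forest r'

/-- Put the trees of a forest on the leaves of `t`, from left to right. -/
def attach : BTree → List BTree → BTree
  | leaf, fs => fs.headD leaf
  | node l r, fs => node (l.attach (fs.take l.leaves)) (r.attach (fs.drop l.leaves))

/-- The total number of leaves of a forest. -/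
def forestLeaves : List BTree → ℕ
  | [] => 0
  | t :: fs => t.leaves + forestLeaves fs

theorem forestLeaves_append (fs gs : List BTree) :
    forestLeaves (fs ++ gs) = forestLeaves fs + forestLeaves gs := by
  induction fs with
  | nil => simp [forestLeaves]
  | cons t fs ih => simp [forestLeaves, ih, add_assoc]

theorem leaves_pos : ∀ t : BTree, 0 < t.leaves
  | leaf => Nat.one_pos
  | node l _ => Nat.add_pos_left (leaves_pos l) _

theorem length_forest : ∀ {t s : BTree}, t ≤ s → (t.forest s).length = t.leaves
  | leaf, _, _ => rfl
  | node _ _, leaf, h => (not_node_le_leaf h).elim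
  | node _ _, node _ _, h => by
    simp [forest, leaves, length_forest h.1, length_forest h.2]

theorem forestLeaves_forest : ∀ {t s : BTree}, t ≤ s → forestLeaves (t.forest s) = s.leaves
  | leaf, _, _ => by simp [forest, forestLeaves]
  | node _ _, leaf, h => (not_node_le_leaf h).elim
  | node _ _, node _ _, h => by
    simp [forest, leaves, forestLeaves_append, forestLeaves_forest h.1, forestLeaves_forest h.2]

theorem attach_forest : ∀ {t s : BTree}, t ≤ s → t.attach (t.forest s) = s
  | leaf, _, _ => rfl
  | node _ _, leaf, h => (not_node_le_leaf h).elim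
  | node l r, node l' r', h => by
    have h1 := length_forest h.1
    simp [forest, attach, ← h1, attach_forest h.1, attach_forest h.2]

theorem le_attach : ∀ (t : BTree) (fs : List BTree), t ≤ t.attach fs
  | leaf, _ => leaf_le _
  | node l r, _ => ⟨le_attach l _, le_attach r _⟩

theorem forest_attach : ∀ (t : BTree) (fs : List BTree), fs.length = t.leaves →
    t.forest (t.attach fs) = fs
  | leaf, fs, h => by
    obtain ⟨f, rfl⟩ := List.length_eq_one_iff.1 h
    rfl
  | node l r, fs, h => by
    simp only [leaves] at h
    rw [attach, forest, forest_attach l _ (by simp [h]), forest_attach r _ (by simp [h]),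
      List.take_append_drop]

theorem length_intervals : ∀ (t : BTree) (a b : ℝ), (t.intervals a b).length = t.leaves
  | leaf, _, _ => rfl
  | node l r, a, b => by simp [intervals, leaves, length_intervals l, length_intervals r]

theorem intervals_attach : ∀ (t : BTree) (fs : List BTree) (a b : ℝ), fs.length = t.leaves →
    (t.attach fs).intervals a b =
      (List.zipWith (fun (I : ℝ × ℝ) (f : BTree) => f.intervals I.1 I.2)
        (t.intervals a b) fs).flatten
  | leaf, fs, a, b, h => by
    obtain ⟨f, rfl⟩ := List.length_eq_one_iff.1 h
    simp [attach, intervals]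
  | node l r, fs, a, b, h => by
    simp only [leaves] at h
    conv_rhs => rw [← List.take_append_drop l.leaves fs]
    rw [attach, intervals, intervals_attach l _ _ _ (by simp [h]),
      intervals_attach r _ _ _ (by simp [h]), intervals,
      List.zipWith_append (by simp [length_intervals, h]), List.flatten_append]

theorem mem_intervals : ∀ (t : BTree) (a b : ℝ), a < b → ∀ I ∈ t.intervals a b,
    a ≤ I.1 ∧ I.1 < I.2 ∧ I.2 ≤ b
  | leaf, a, b, h, I, hI => by
    simp only [intervals, List.mem_singleton] at hI
    subst hI
    exact ⟨le_rfl, h, le_rfl⟩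
  | node l r, a, b, h, I, hI => by
    simp only [intervals, List.mem_append] at hI
    rcases hI with hI | hI
    · have := mem_intervals l _ _ (by linarith) I hI
      exact ⟨this.1, this.2.1, by linarith [this.2.2]⟩
    · have := mem_intervals r _ _ (by linarith) I hI
      exact ⟨by linarith [this.1], this.2.1, this.2.2⟩

theorem intervals_node_left (l r : BTree) {a b : ℝ} (h : a < b) :
    ((node l r).intervals a b).filter (fun I => decide (I.2 ≤ (a + b) / 2)) =
      l.intervals a ((a + b) / 2) := by
  rw [intervals, List.filter_append, List.filter_eq_self.2, List.filter_eq_nil_iff.2,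
    List.append_nil]
  · intro I hI
    have := mem_intervals r _ _ (by linarith) I hI
    simp only [decide_eq_true_eq]
    linarith [this.1, this.2.1]
  · intro I hI
    have := mem_intervals l _ _ (by linarith) I hI
    simpa using this.2.2

theorem intervals_injective : ∀ (t s : BTree) (a b : ℝ), a < b →
    t.intervals a b = s.intervals a b → t = s
  | leaf, leaf, _, _, _, _ => rfl
  | leaf, node l r, a, b, h, he => by
    have := congrArg List.length he
    simp only [length_intervals, leaves] at this
    have h1 := leaves_pos l
    have h2 := leaves_pos r
    omega
  | node l r, leaf, a, b, h, he => by
    have := congrArg List.length he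
    simp only [length_intervals, leaves] at this
    have h1 := leaves_pos l
    have h2 := leaves_pos r
    omega
  | node l r, node l' r', a, b, h, he => by
    have hl : l.intervals a ((a + b) / 2) = l'.intervals a ((a + b) / 2) := by
      rw [← intervals_node_left l r h, ← intervals_node_left l' r' h, he]
    have hr : r.intervals ((a + b) / 2) b = r'.intervals ((a + b) / 2) b := by
      rw [intervals, intervals, hl] at he
      exact List.append_cancel_left he
    rw [intervals_injective l l' _ _ (by linarith) hl,
      intervals_injective r r' _ _ (by linarith) hr]

end BTree

open BTree

/-- `g` maps the interval `I` affinely onto the interval `J`, preserving orientation. -/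
def MapsAffinely (g : unitInterval ≃ₜ unitInterval) (J I : ℝ × ℝ) : Prop :=
  ∀ p ∈ Set.Icc (0 : ℝ) 1, ∀ x : unitInterval,
    (x : ℝ) = I.1 + p * (I.2 - I.1) → (g x : ℝ) = J.1 + p * (J.2 - J.1)

/-- `(s, t)` is a pair of trees representing `g`: the two trees have the same number of leaves,
and `g` maps the `i`-th interval of the dyadic partition of `t` affinely onto the `i`-th
interval of that of `s`.  (The partition of `t` is "good" for `g`, and `g` sends it to that
of `s`.) -/
def IsTreePair (g : unitInterval ≃ₜ unitInterval) (s t : BTree) : Prop :=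
  List.Forall₂ (MapsAffinely g) (s.intervals 0 1) (t.intervals 0 1)

theorem MapsAffinely.intervals {g : unitInterval ≃ₜ unitInterval} : ∀ (f : BTree) (J I : ℝ × ℝ),
    MapsAffinely g J I →
      List.Forall₂ (MapsAffinely g) (f.intervals J.1 J.2) (f.intervals I.1 I.2)
  | leaf, _, _, h => List.Forall₂.cons h List.Forall₂.nil
  | node l r, J, I, h => by
    refine List.rel_append (MapsAffinely.intervals l (J.1, (J.1 + J.2) / 2)
      (I.1, (I.1 + I.2) / 2) ?_) (MapsAffinely.intervals r ((J.1 + J.2) / 2, J.2)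
      ((I.1 + I.2) / 2, I.2) ?_)
    · intro p hp x hx
      rw [h (p / 2) ⟨by linarith [hp.1], by linarith [hp.2]⟩ x (by rw [hx]; ring)]
      ring
    · intro p hp x hx
      rw [h ((1 + p) / 2) ⟨by linarith [hp.1], by linarith [hp.2]⟩ x (by rw [hx]; ring)]
      ring

theorem IsTreePair.leaves_eq {g : unitInterval ≃ₜ unitInterval} {s t : BTree}
    (h : IsTreePair g s t) : s.leaves = t.leaves := by
  rw [← length_intervals s 0 1, ← length_intervals t 0 1]
  exact h.length_eq

theorem forall₂_flatten {g : unitInterval ≃ₜ unitInterval} {Js Is : List (ℝ × ℝ)}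
    (h : List.Forall₂ (MapsAffinely g) Js Is) (fs : List BTree) :
    List.Forall₂ (MapsAffinely g)
      (List.zipWith (fun (I : ℝ × ℝ) (f : BTree) => f.intervals I.1 I.2) Js fs).flatten
      (List.zipWith (fun (I : ℝ × ℝ) (f : BTree) => f.intervals I.1 I.2) Is fs).flatten := by
  induction h generalizing fs with
  | nil => simp
  | cons h _ ih =>
    cases fs with
    | nil => simp
    | cons f fs =>
      simp only [List.zipWith_cons_cons, List.flatten_cons]
      exact List.rel_append (MapsAffinely.intervals f _ _ h) (ih fs)

theorem IsTreePair.refine {g : unitInterval ≃ₜ unitInterval} {s t u : BTree}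
    (h : IsTreePair g s t) (htu : t ≤ u) :
    IsTreePair g (s.attach (t.forest u)) u := by
  have hl : (t.forest u).length = t.leaves := length_forest htu
  have := forall₂_flatten h (t.forest u)
  rw [← intervals_attach _ _ _ _ hl, ← intervals_attach _ _ _ _ (hl.trans h.leaves_eq.symm),
    attach_forest htu] at this
  exact this

theorem IsTreePair.unique {g : unitInterval ≃ₜ unitInterval} {s s' t : BTree}
    (h : IsTreePair g s t) (h' : IsTreePair g s' t) : s = s' := by
  have key : ∀ (Is : List (ℝ × ℝ)), (∀ I ∈ Is, (0 : ℝ) ≤ I.1 ∧ I.1 < I.2 ∧ I.2 ≤ 1) →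
      ∀ Js Js', List.Forall₂ (MapsAffinely g) Js Is → List.Forall₂ (MapsAffinely g) Js' Is →
      Js = Js' := by
    intro Is
    induction Is with
    | nil =>
      intro _ Js Js' h h'
      cases h
      cases h'
      rfl
    | cons I Is ih =>
      intro hI Js Js' h h'
      obtain ⟨J, Js, hJ, hJs, rfl⟩ := List.forall₂_cons_right_iff.1 h
      obtain ⟨J', Js', hJ', hJs', rfl⟩ := List.forall₂_cons_right_iff.1 h'
      obtain ⟨h0, h1, h2⟩ := hI I (by simp)
      have e1 : J.1 = J'.1 := by
        have a := hJ 0 (by simp) ⟨I.1, h0, by linarith⟩ (by simp)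
        have b := hJ' 0 (by simp) ⟨I.1, h0, by linarith⟩ (by simp)
        simp only [zero_mul, add_zero] at a b
        rw [← a, ← b]
      have e2 : J.2 = J'.2 := by
        have a := hJ 1 (by simp) ⟨I.2, by linarith, h2⟩ (by simp)
        have b := hJ' 1 (by simp) ⟨I.2, by linarith, h2⟩ (by simp)
        simp only [one_mul, add_sub_cancel] at a b
        rw [← a, ← b]
      rw [Prod.ext e1 e2, ih (fun I hI' => hI I (by simp [hI'])) _ _ hJs hJs']
  exact intervals_injective _ _ 0 1 one_pos
    (key _ (mem_intervals t 0 1 one_pos) _ _ h h')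

theorem isTreePair_one (t : BTree) : IsTreePair 1 t t := by
  refine List.forall₂_same.2 fun I _ p _ x hx => ?_
  simpa using hx

theorem IsTreePair.inv {g : unitInterval ≃ₜ unitInterval} {s t : BTree}
    (h : IsTreePair g s t) : IsTreePair g⁻¹ t s := by
  have key : ∀ (Js Is : List (ℝ × ℝ)), (∀ I ∈ Is, (0 : ℝ) ≤ I.1 ∧ I.1 < I.2 ∧ I.2 ≤ 1) →
      List.Forall₂ (MapsAffinely g) Js Is → List.Forall₂ (MapsAffinely g⁻¹) Is Js := by
    intro Js Is hI h
    induction h with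
    | nil => exact List.Forall₂.nil
    | @cons J I Js Is h _ ih =>
      refine List.Forall₂.cons ?_ (ih fun I hI' => hI I (by simp [hI']))
      intro p hp y hy
      obtain ⟨h0, h1, h2⟩ := hI I (by simp)
      have hx : I.1 + p * (I.2 - I.1) ∈ Set.Icc (0 : ℝ) 1 :=
        ⟨by nlinarith [hp.1], by nlinarith [hp.2]⟩
      have : g ⟨_, hx⟩ = y := Subtype.ext (by rw [h p hp ⟨_, hx⟩ rfl, hy])
      rw [← this]
      change ((g.symm (g ⟨_, hx⟩) : unitInterval) : ℝ) = _
      rw [g.symm_apply_apply]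
  exact key _ _ (mem_intervals t 0 1 one_pos) h

theorem IsTreePair.mul {g h : unitInterval ≃ₜ unitInterval} {s t u : BTree}
    (hg : IsTreePair g s t) (hh : IsTreePair h t u) : IsTreePair (g * h) s u := by
  have key : ∀ (Js Is Ks : List (ℝ × ℝ)), List.Forall₂ (MapsAffinely g) Js Is →
      List.Forall₂ (MapsAffinely h) Is Ks → List.Forall₂ (MapsAffinely (g * h)) Js Ks := by
    intro Js Is Ks h1
    induction h1 generalizing Ks with
    | nil =>
      intro h2
      cases h2
      exact List.Forall₂.nil
    | cons h1 _ ih =>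
      intro h2
      cases h2 with
      | cons h2 h2' =>
        exact List.Forall₂.cons (fun p hp x hx => h1 p hp (h x) (h2 p hp x hx)) (ih _ h2')
  exact key _ _ _ hg hh

theorem IsTreePair.exists_mul {g h : unitInterval ≃ₜ unitInterval} {s t u v : BTree}
    (hg : IsTreePair g s t) (hh : IsTreePair h u v) :
    ∃ a b c, u ≤ b ∧ t ≤ b ∧ v ≤ c ∧ IsTreePair g a b ∧ IsTreePair h b c := by
  obtain ⟨b, htb, hub⟩ := exists_ge_ge t u
  refine ⟨_, b, v.attach (u.forest b), hub, htb, le_attach _ _, hg.refine htb, ?_⟩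
  simpa using (hh.inv.refine hub).inv

/-- Thompson's group `F`: the homeomorphisms of `[0,1]` that map the intervals of some standard
dyadic partition affinely onto the intervals of another one, in order; the multiplication is
composition. -/
def thompsonF : Subgroup (unitInterval ≃ₜ unitInterval) where
  carrier := {g | ∃ s t, IsTreePair g s t}
  one_mem' := ⟨leaf, leaf, isTreePair_one leaf⟩
  mul_mem' := by
    rintro g h ⟨s, t, hg⟩ ⟨u, v, hh⟩
    obtain ⟨a, b, c, -, -, -, h1, h2⟩ := hg.exists_mul hh
    exact ⟨a, c, h1.mul h2⟩
  inv_mem' := by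
    rintro g ⟨s, t, h⟩
    exact ⟨t, s, h.inv⟩

open scoped ComplexConjugate

/-! ### The Temperley–Lieb algebra -/

/-- The elementary diagrams: `cup i` creates, and `cap i` joins, the points in positions `i` and
`i + 1`; all the other strings go straight through. -/
inductive Gen : Type
  | cup : ℕ → Gen
  | cap : ℕ → Gen

/-- Formal linear combinations of vertical stacks of elementary diagrams. -/
abbrev Formal : Type := MonoidAlgebra ℂ (FreeMonoid Gen)

/-- An elementary diagram, as a formal combination. -/
noncomputable def fgen (g : Gen) : Formal := MonoidAlgebra.of ℂ (FreeMonoid Gen) (FreeMonoid.of g)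

/-- The loop value `δ = √3`. -/
noncomputable def loopValue : ℂ := ((Real.sqrt 3 : ℝ) : ℂ)

/-- The relations of planar isotopy, and the loop relation. -/
inductive TLRel : Formal → Formal → Prop
  | loop (i : ℕ) :
      TLRel (fgen (.cap i) * fgen (.cup i)) (algebraMap ℂ Formal loopValue)
  | zig (i : ℕ) : TLRel (fgen (.cap i) * fgen (.cup (i + 1))) 1
  | zag (i : ℕ) : TLRel (fgen (.cap (i + 1)) * fgen (.cup i)) 1
  | cup_cup (i j : ℕ) : i ≤ j →
      TLRel (fgen (.cup (j + 2)) * fgen (.cup i)) (fgen (.cup i) * fgen (.cup j))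
  | cap_cap (i j : ℕ) : i ≤ j →
      TLRel (fgen (.cap i) * fgen (.cap (j + 2))) (fgen (.cap j) * fgen (.cap i))
  | cap_cup (i j : ℕ) : i ≤ j →
      TLRel (fgen (.cap i) * fgen (.cup (j + 2))) (fgen (.cup j) * fgen (.cap i))
  | cap_cup' (i j : ℕ) : i ≤ j →
      TLRel (fgen (.cap (j + 2)) * fgen (.cup i)) (fgen (.cup i) * fgen (.cap j))

/-- The Temperley–Lieb diagrams with loop value `√3`, up to isotopy and with complex
coefficients.  A diagram is identified with the one that has further strings going straight
through on its right.  The product `x * y` is the stack of the diagram `x` on the outputs of the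
diagram `y`. -/
def TL : Type := RingQuot TLRel

noncomputable instance : Ring TL := inferInstanceAs (Ring (RingQuot TLRel))
noncomputable instance : Algebra ℂ TL := inferInstanceAs (Algebra ℂ (RingQuot TLRel))

namespace TL

/-- The class of a formal combination of diagrams. -/
noncomputable def mk : Formal →ₐ[ℂ] TL := RingQuot.mkAlgHom ℂ TLRel

theorem mk_surjective : Function.Surjective mk := RingQuot.mkAlgHom_surjective ℂ TLRel

theorem mk_rel {x y : Formal} (h : TLRel x y) : mk x = mk y := RingQuot.mkAlgHom_rel ℂ h

/-- The diagram `cup i`. -/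
noncomputable def cup (i : ℕ) : TL := mk (fgen (.cup i))
/-- The diagram `cap i`. -/
noncomputable def cap (i : ℕ) : TL := mk (fgen (.cap i))

theorem cap_mul_cup_self (i : ℕ) : cap i * cup i = algebraMap ℂ TL loopValue := by
  have h := mk_rel (.loop i)
  rw [map_mul, AlgHom.commutes] at h
  exact h
theorem zig (i : ℕ) : cap i * cup (i + 1) = 1 := by simpa [cup, cap] using mk_rel (.zig i)
theorem zag (i : ℕ) : cap (i + 1) * cup i = 1 := by simpa [cup, cap] using mk_rel (.zag i)
theorem cup_mul_cup {i j : ℕ} (h : i ≤ j) : cup (j + 2) * cup i = cup i * cup j := by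
  simpa [cup, cap] using mk_rel (.cup_cup i j h)
theorem cap_mul_cap {i j : ℕ} (h : i ≤ j) : cap i * cap (j + 2) = cap j * cap i := by
  simpa [cup, cap] using mk_rel (.cap_cap i j h)
theorem cap_mul_cup {i j : ℕ} (h : i ≤ j) : cap i * cup (j + 2) = cup j * cap i := by
  simpa [cup, cap] using mk_rel (.cap_cup i j h)
theorem cap_mul_cup' {i j : ℕ} (h : i ≤ j) : cap (j + 2) * cup i = cup i * cap j := by
  simpa [cup, cap] using mk_rel (.cap_cup' i j h)

theorem induction {C : TL → Prop} (scalar : ∀ c : ℂ, C (algebraMap ℂ TL c))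
    (cup_mul : ∀ i x, C x → C (cup i * x)) (cap_mul : ∀ i x, C x → C (cap i * x))
    (smul : ∀ (c : ℂ) x, C x → C (c • x))
    (add : ∀ x y, C x → C y → C (x + y)) (x : TL) : C x := by
  obtain ⟨x, rfl⟩ := mk_surjective x
  induction x using MonoidAlgebra.induction_on with
  | of w =>
    induction w using FreeMonoid.recOn with
    | one => rw [map_one, map_one]; simpa using scalar 1
    | of_mul g w ih =>
      rw [map_mul, map_mul]
      cases g with
      | cup i => exact cup_mul i _ ih
      | cap i => exact cap_mul i _ ih
  | add x y hx hy => rw [map_add]; exact add _ _ hx hy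
  | smul c x hx => rw [map_smul]; exact smul _ _ hx

/-- Algebra maps out of `TL`. -/
noncomputable def lift {B : Type*} [Semiring B] [Algebra ℂ B] (f : Gen → B)
    (h : ∀ ⦃x y : Formal⦄, TLRel x y →
      MonoidAlgebra.lift ℂ B (FreeMonoid Gen) (FreeMonoid.lift f) x =
        MonoidAlgebra.lift ℂ B (FreeMonoid Gen) (FreeMonoid.lift f) y) : TL →ₐ[ℂ] B :=
  RingQuot.liftAlgHom ℂ ⟨_, h⟩

theorem lift_mk {B : Type*} [Semiring B] [Algebra ℂ B] (f : Gen → B) (h) (x : Formal) :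
    lift f h (mk x) = MonoidAlgebra.lift ℂ B (FreeMonoid Gen) (FreeMonoid.lift f) x :=
  RingQuot.liftAlgHom_mkAlgHom_apply ℂ _ h x

theorem lift_fgen {B : Type*} [Semiring B] [Algebra ℂ B] (f : Gen → B) (g : Gen) :
    MonoidAlgebra.lift ℂ B (FreeMonoid Gen) (FreeMonoid.lift f) (fgen g) = f g := by
  simp [fgen]

/-- Two strings are added on the left. -/
noncomputable def shift : TL →ₐ[ℂ] TL :=
  lift (fun g => match g with
    | .cup i => cup (i + 2)
    | .cap i => cap (i + 2)) (by
    intro _ _ h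
    cases h <;> simp only [map_mul, map_one, lift_fgen, AlgHom.commutes]
    case loop i => exact cap_mul_cup_self _
    case zig i => exact zig _
    case zag i => exact zag _
    case cup_cup i j h => exact cup_mul_cup (by omega)
    case cap_cap i j h => exact cap_mul_cap (by omega)
    case cap_cup i j h => exact cap_mul_cup (by omega)
    case cap_cup' i j h => exact cap_mul_cup' (by omega))

theorem shift_cup (i : ℕ) : shift (cup i) = cup (i + 2) := by
  rw [shift, cup, lift_mk, lift_fgen]
theorem shift_cap (i : ℕ) : shift (cap i) = cap (i + 2) := by
  rw [shift, cap, lift_mk, lift_fgen]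

/-- The mirror image of an elementary diagram in a horizontal line. -/
def Gen.mirror : Gen → Gen
  | .cup i => .cap i
  | .cap i => .cup i

noncomputable def adjFormal : Formal →+* TLᵐᵒᵖ :=
  MonoidAlgebra.liftNCRingHom ((algebraMap ℂ TLᵐᵒᵖ).comp (starRingEnd ℂ))
    (FreeMonoid.lift fun g => MulOpposite.op (mk (fgen (Gen.mirror g))))
    (fun x _ => Algebra.commute_algebraMap_left (starRingEnd ℂ x) _)

theorem adjFormal_fgen (g : Gen) :
    adjFormal (fgen g) = MulOpposite.op (mk (fgen (Gen.mirror g))) := by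
  rw [adjFormal, fgen, MonoidAlgebra.of_apply, MonoidAlgebra.liftNCRingHom_single]
  simp

theorem adjFormal_algebraMap (c : ℂ) :
    adjFormal (algebraMap ℂ Formal c) = algebraMap ℂ TLᵐᵒᵖ (conj c) := by
  rw [adjFormal, MonoidAlgebra.coe_algebraMap, Function.comp_apply,
    MonoidAlgebra.liftNCRingHom_single]
  simp

theorem conj_loopValue : conj loopValue = loopValue := Complex.conj_ofReal _

/-- The adjoint as a ring map to the opposite ring. -/
noncomputable def adjHom : TL →+* TLᵐᵒᵖ :=
  RingQuot.lift ⟨adjFormal, by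
    intro x y h
    cases h <;> simp only [map_mul, map_one, adjFormal_fgen, adjFormal_algebraMap, Gen.mirror,
      ← MulOpposite.op_mul, ← MulOpposite.op_one, conj_loopValue, MulOpposite.algebraMap_apply]
      <;> congr 1
    case loop i => exact cap_mul_cup_self _
    case zig i => exact zag _
    case zag i => exact zig _
    case cup_cup i j h => exact cap_mul_cap h
    case cap_cap i j h => exact cup_mul_cup h
    case cap_cup i j h => exact cap_mul_cup' h
    case cap_cup' i j h => exact cap_mul_cup h⟩

theorem adjHom_mk (x : Formal) : adjHom (mk x) = adjFormal x := by
  have : mk x = RingQuot.mkRingHom TLRel x := by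
    rw [mk, ← RingQuot.mkAlgHom_coe ℂ]; rfl
  rw [this]
  exact RingQuot.lift_mkRingHom_apply _ _ _

/-- The adjoint of a diagram is its mirror image in a horizontal line; the adjoint is conjugate
linear. -/
noncomputable instance : Star TL := ⟨fun x => (adjHom x).unop⟩

theorem star_def (x : TL) : star x = (adjHom x).unop := rfl
theorem star_cup (i : ℕ) : star (cup i) = cap i := by
  rw [star_def, cup, adjHom_mk, adjFormal_fgen]; rfl
theorem star_cap (i : ℕ) : star (cap i) = cup i := by
  rw [star_def, cap, adjHom_mk, adjFormal_fgen]; rfl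
theorem star_algebraMap' (c : ℂ) : star (algebraMap ℂ TL c) = algebraMap ℂ TL (conj c) := by
  rw [star_def, ← AlgHom.commutes mk, adjHom_mk, adjFormal_algebraMap]; rfl
theorem star_mul' (x y : TL) : star (x * y) = star y * star x := by
  simp only [star_def, map_mul, MulOpposite.unop_mul]
theorem star_add' (x y : TL) : star (x + y) = star x + star y := by
  simp only [star_def, map_add, MulOpposite.unop_add]
theorem star_smul' (c : ℂ) (x : TL) : star (c • x) = conj c • star x := by
  rw [Algebra.smul_def, star_mul', star_algebraMap', ← Algebra.commutes, ← Algebra.smul_def]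
theorem star_star' (x : TL) : star (star x) = x := by
  induction x using TL.induction with
  | scalar c => simp [star_algebraMap']
  | cup_mul i x ih => rw [star_mul', star_mul', ih, star_cup, star_cap]
  | cap_mul i x ih => rw [star_mul', star_mul', ih, star_cap, star_cup]
  | smul c x ih => simp [star_smul', ih]
  | add x y hx hy => rw [star_add', star_add', hx, hy]

noncomputable instance : StarRing TL where
  star_involutive := star_star'
  star_mul := star_mul'
  star_add := star_add'

instance : StarModule ℂ TL := ⟨star_smul'⟩

theorem star_shift (x : TL) : star (shift x) = shift (star x) := by
  induction x using TL.induction with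
  | scalar c => simp [star_algebraMap']
  | cup_mul i x ih => simp [star_cup, shift_cup, shift_cap, ih]
  | cap_mul i x ih => simp [star_cap, shift_cup, shift_cap, ih]
  | smul c x ih => simp [ih]
  | add x y hx hy => simp [hx, hy]

theorem loopValue_ne_zero : loopValue ≠ 0 := by
  simp [loopValue]

theorem loopValue_mul_self : loopValue * loopValue = 3 := by
  rw [loopValue, ← Complex.ofReal_mul, Real.mul_self_sqrt (by norm_num)]; norm_num

/-- The diagrams with `m` inputs and `n` outputs. -/
inductive IsDiagram (m : ℕ) : ℕ → TL → Prop
  | one : IsDiagram m m 1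
  | cup_mul {n : ℕ} {x : TL} (i : ℕ) : i ≤ n → IsDiagram m n x → IsDiagram m (n + 2) (cup i * x)
  | cap_mul {n : ℕ} {x : TL} (i : ℕ) : i ≤ n → IsDiagram m (n + 2) x → IsDiagram m n (cap i * x)

/-- The space of linear combinations of diagrams with `m` inputs and `n` outputs. -/
noncomputable def Hom (m n : ℕ) : Submodule ℂ TL := Submodule.span ℂ {x | IsDiagram m n x}

theorem IsDiagram.mul {m n k : ℕ} {x y : TL} (hx : IsDiagram n k x) (hy : IsDiagram m n y) :
    IsDiagram m k (x * y) := by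
  induction hx with
  | one => simpa using hy
  | cup_mul i h _ ih => rw [mul_assoc]; exact .cup_mul i h ih
  | cap_mul i h _ ih => rw [mul_assoc]; exact .cap_mul i h ih

theorem Hom.mul {m n k : ℕ} {x y : TL} (hx : x ∈ Hom n k) (hy : y ∈ Hom m n) :
    x * y ∈ Hom m k := by
  have := Submodule.mul_mem_mul hx hy
  rw [Hom, Hom, Submodule.span_mul_span] at this
  refine Submodule.span_mono ?_ this
  rintro _ ⟨a, ha, b, hb, rfl⟩
  exact IsDiagram.mul ha hb

theorem IsDiagram.mem {m n : ℕ} {x : TL} (h : IsDiagram m n x) : x ∈ Hom m n :=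
  Submodule.subset_span h

theorem cup_mem {i n : ℕ} (h : i ≤ n) : cup i ∈ Hom n (n + 2) := by
  simpa using (IsDiagram.cup_mul i h (IsDiagram.one (m := n))).mem

theorem cap_mem {i n : ℕ} (h : i ≤ n) : cap i ∈ Hom (n + 2) n := by
  simpa using (IsDiagram.cap_mul i h (IsDiagram.one (m := n + 2))).mem

theorem one_mem (n : ℕ) : (1 : TL) ∈ Hom n n := (IsDiagram.one).mem

theorem Hom.star {m n : ℕ} {x : TL} (hx : x ∈ Hom m n) : star x ∈ Hom n m := by
  induction hx using Submodule.span_induction with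
  | mem x h =>
    induction h with
    | one => simpa using one_mem m
    | cup_mul i h _ ih => rw [star_mul, star_cup]; exact Hom.mul ih (cap_mem h)
    | cap_mul i h _ ih => rw [star_mul, star_cap]; exact Hom.mul ih (cup_mem h)
  | zero => simp
  | add x y _ _ hx hy => rw [star_add]; exact add_mem hx hy
  | smul c x _ hx => rw [star_smul]; exact Submodule.smul_mem _ _ hx

theorem Hom.add_right {m n : ℕ} {x : TL} (k : ℕ) (hx : x ∈ Hom m n) : x ∈ Hom (m + k) (n + k) := by
  induction hx using Submodule.span_induction with
  | mem x h =>
    refine IsDiagram.mem ?_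
    induction h with
    | one => exact .one
    | cup_mul i h _ ih => rw [add_right_comm]; exact .cup_mul i (by omega) ih
    | cap_mul i h _ ih => exact .cap_mul i (by omega) (by rw [add_right_comm]; exact ih)
  | zero => simp
  | add x y _ _ hx hy => exact add_mem hx hy
  | smul c x _ hx => exact Submodule.smul_mem _ _ hx

theorem Hom.shift {m n : ℕ} {x : TL} (hx : x ∈ Hom m n) : TL.shift x ∈ Hom (m + 2) (n + 2) := by
  induction hx using Submodule.span_induction with
  | mem x h =>
    refine IsDiagram.mem ?_
    induction h with
    | one => rw [map_one]; exact .one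
    | cup_mul i h _ ih => rw [map_mul, shift_cup]; exact .cup_mul _ (by omega) ih
    | cap_mul i h _ ih => rw [map_mul, shift_cap]; exact .cap_mul _ (by omega) ih
  | zero => simp
  | add x y _ _ hx hy => rw [map_add]; exact add_mem hx hy
  | smul c x _ hx => rw [map_smul]; exact Submodule.smul_mem _ _ hx

/-! Every diagram is a combination of diagrams in which all the caps come before the cups. -/

inductive Caps (m : ℕ) : ℕ → TL → Prop
  | one : Caps m m 1
  | cap_mul {n : ℕ} {x : TL} (i : ℕ) : i ≤ n → Caps m (n + 2) x → Caps m n (cap i * x)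

inductive Normal (m : ℕ) : ℕ → TL → Prop
  | caps {n : ℕ} {x : TL} : Caps m n x → Normal m n x
  | cup_mul {n : ℕ} {x : TL} (i : ℕ) : i ≤ n → Normal m n x → Normal m (n + 2) (cup i * x)

theorem mul_mem_span {a x : TL} {S T : Set TL} (h : ∀ y ∈ S, a * y ∈ Submodule.span ℂ T)
    (hx : x ∈ Submodule.span ℂ S) : a * x ∈ Submodule.span ℂ T := by
  induction hx using Submodule.span_induction with
  | mem y hy => exact h y hy
  | zero => simp
  | add y z _ _ hy hz => rw [mul_add]; exact add_mem hy hz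
  | smul c y _ hy => rw [mul_smul_comm]; exact Submodule.smul_mem _ _ hy

theorem Normal.cap_mul {m n : ℕ} {x : TL} (h : Normal m n x) : ∀ (k i : ℕ), n = k + 2 → i ≤ k →
    cap i * x ∈ Submodule.span ℂ {y | Normal m k y} := by
  induction h with
  | caps h =>
    rintro k i rfl hi
    exact Submodule.subset_span (.caps (.cap_mul i hi h))
  | @cup_mul n x j hj hx ih =>
    intro k i hn hi
    obtain rfl : n = k := by omega
    rw [← mul_assoc]
    have step : ∀ (n' a b : ℕ), n = n' + 2 → a ≤ n' → b ≤ n' →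
        cup a * (cap b * x) ∈ Submodule.span ℂ {y | Normal m n y} := by
      rintro n' a b rfl ha hb
      exact mul_mem_span (fun y hy => Submodule.subset_span (.cup_mul a ha hy)) (ih n' b rfl hb)
    have hxm : x ∈ Submodule.span ℂ {y | Normal m n y} := Submodule.subset_span hx
    rcases lt_trichotomy i j with hij | rfl | hij
    · obtain rfl | hij : j = i + 1 ∨ i + 2 ≤ j := by omega
      · rwa [zig, one_mul]
      · obtain ⟨j, rfl⟩ := Nat.exists_eq_add_of_le' (show 2 ≤ j by omega)
        rw [cap_mul_cup (by omega), mul_assoc]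
        exact step (n - 2) _ _ (by omega) (by omega) (by omega)
    · rw [cap_mul_cup_self, ← Algebra.smul_def]
      exact Submodule.smul_mem _ _ hxm
    · obtain rfl | hij : i = j + 1 ∨ j + 2 ≤ i := by omega
      · rwa [zag, one_mul]
      · obtain ⟨i, rfl⟩ := Nat.exists_eq_add_of_le' (show 2 ≤ i by omega)
        rw [cap_mul_cup' (by omega), mul_assoc]
        exact step (n - 2) _ _ (by omega) (by omega) (by omega)

theorem Hom.le_normal (m n : ℕ) : Hom m n ≤ Submodule.span ℂ {y | Normal m n y} := by
  refine Submodule.span_le.2 ?_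
  intro x hx
  simp only [SetLike.mem_coe]
  induction hx with
  | one => exact Submodule.subset_span (.caps .one)
  | cup_mul i h _ ih =>
    exact mul_mem_span (fun y hy => Submodule.subset_span (.cup_mul i h hy)) ih
  | cap_mul i h _ ih => exact mul_mem_span (fun y hy => hy.cap_mul _ _ rfl h) ih

theorem Caps.le {m n : ℕ} {x : TL} (h : Caps m n x) : n ≤ m := by
  induction h <;> omega

theorem Caps.eq_one {m n : ℕ} {x : TL} (h : Caps m n x) (hn : n = m) : x = 1 := by
  cases h with
  | one => rfl
  | cap_mul i _ h => have := h.le; omega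

theorem Hom.two_two {x : TL} (hx : x ∈ Hom 2 2) :
    ∃ a b : ℂ, x = a • (1 : TL) + b • (cup 0 * cap 0) := by
  have h0 : ∀ {n : ℕ} {y : TL}, Caps 2 n y → n = 0 → y = cap 0 := by
    intro n y hy hn
    cases hy with
    | one => omega
    | cap_mul i hi hy =>
      obtain rfl : i = 0 := by omega
      rw [hy.eq_one (by omega), mul_one]
  have h : x ∈ Submodule.span ℂ {1, cup 0 * cap 0} := by
    refine (Hom.le_normal 2 2).trans (Submodule.span_le.2 ?_) hx
    intro y hy
    refine Submodule.subset_span ?_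
    simp only [Set.mem_insert_iff, Set.mem_singleton_iff]
    have h2 : ∀ {n : ℕ} {y : TL}, Normal 2 n y → n = 2 → y = 1 ∨ y = cup 0 * cap 0 := by
      intro n y hy hn
      cases hy with
      | caps hy => exact .inl (hy.eq_one hn)
      | @cup_mul n y i hi hy =>
        obtain rfl : n = 0 := by omega
        obtain rfl : i = 0 := by omega
        right
        generalize hk : 0 = k at hy
        cases hy with
        | caps hy => subst hk; rw [h0 hy rfl]
        | cup_mul => omega
    exact h2 hy rfl
  obtain ⟨a, b, h⟩ := Submodule.mem_span_pair.1 h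
  exact ⟨a, b, h.symm⟩


/-! ### Positivity

An action of diagrams by operators on an inner product space, under which the adjoint of a diagram
acts as the adjoint operator.  It serves to prove that the inner product defined below from the
diagrams alone is well defined and positive. -/

/-- Colourings of every second region between the strings by three colours. -/
abbrev Spins : Type := ℕ → Fin 3

/-- Insert the colour `c` in position `p`. -/
def ins (p : ℕ) (c : Fin 3) (σ : Spins) : Spins :=
  fun j => if j < p then σ j else if j = p then c else σ (j - 1)

/-- Delete the colour in position `p`. -/
def del (p : ℕ) (σ : Spins) : Spins := fun j => if j < p then σ j else σ (j + 1)

theorem del_ins (p : ℕ) (c : Fin 3) (σ : Spins) : del p (ins p c σ) = σ := by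
  funext j; simp only [del, ins]; grind

theorem ins_del (p : ℕ) (σ : Spins) : ins p (σ p) (del p σ) = σ := by
  funext j; simp only [del, ins]; grind

theorem ins_ins {p q : ℕ} (h : p ≤ q) (c d : Fin 3) (σ : Spins) :
    ins (q + 1) d (ins p c σ) = ins p c (ins q d σ) := by
  funext j; simp only [ins]; grind

theorem del_del {p q : ℕ} (h : p ≤ q) (σ : Spins) :
    del p (del (q + 1) σ) = del q (del p σ) := by
  funext j; simp only [del]; grind

theorem del_ins_of_le {p q : ℕ} (h : p ≤ q) (c : Fin 3) (σ : Spins) :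
    del p (ins (q + 1) c σ) = ins q c (del p σ) := by
  funext j; simp only [del, ins]; grind

theorem del_ins_of_le' {p q : ℕ} (h : p ≤ q) (c : Fin 3) (σ : Spins) :
    del (q + 1) (ins p c σ) = ins p c (del q σ) := by
  funext j; simp only [del, ins]; grind

theorem del_succ_ins (p : ℕ) (σ : Spins) : del (p + 1) (ins p (σ p) σ) = σ := by
  funext j; simp only [del, ins]; grind

/-- The fourth root of `3`. -/
noncomputable def fourthRoot : ℂ := ((Real.sqrt (Real.sqrt 3) : ℝ) : ℂ)

theorem fourthRoot_mul_self : fourthRoot * fourthRoot = loopValue := by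
  rw [fourthRoot, loopValue, ← Complex.ofReal_mul, Real.mul_self_sqrt (Real.sqrt_nonneg _)]

theorem fourthRoot_ne_zero : fourthRoot ≠ 0 := by
  intro h
  apply loopValue_ne_zero
  rw [← fourthRoot_mul_self, h, zero_mul]

theorem conj_fourthRoot : conj fourthRoot = fourthRoot := Complex.conj_ofReal _

/-- The coefficient of a new colour `c` under `cup i`. -/
noncomputable def cupWt (i : ℕ) (c : Fin 3) (σ : Spins) : ℂ :=
  if i % 2 = 0 then (if σ (i / 2) = c then fourthRoot else 0) else fourthRoot⁻¹

/-- The coefficient of a colouring under `cap i`. -/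
noncomputable def capWt (i : ℕ) (σ : Spins) : ℂ :=
  if i % 2 = 0 then (if σ (i / 2) = σ (i / 2 + 1) then fourthRoot else 0) else fourthRoot⁻¹

noncomputable abbrev ket (σ : Spins) : Spins →₀ ℂ := Finsupp.single σ 1

noncomputable def cupOp (i : ℕ) : Module.End ℂ (Spins →₀ ℂ) :=
  Finsupp.linearCombination ℂ fun σ => ∑ c, cupWt i c σ • ket (ins (i / 2 + 1) c σ)

noncomputable def capOp (i : ℕ) : Module.End ℂ (Spins →₀ ℂ) :=
  Finsupp.linearCombination ℂ fun σ => capWt i σ • ket (del (i / 2 + 1) σ)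

theorem cupOp_ket (i : ℕ) (σ : Spins) :
    cupOp i (ket σ) = ∑ c, cupWt i c σ • ket (ins (i / 2 + 1) c σ) := by
  simp [cupOp, Finsupp.linearCombination_single]

theorem capOp_ket (i : ℕ) (σ : Spins) :
    capOp i (ket σ) = capWt i σ • ket (del (i / 2 + 1) σ) := by
  simp [capOp, Finsupp.linearCombination_single]

theorem end_ext {f g : Module.End ℂ (Spins →₀ ℂ)} (h : ∀ σ, f (ket σ) = g (ket σ)) : f = g :=
  Finsupp.lhom_ext' fun σ => LinearMap.ext_ring (h σ)

theorem capOp_cupOp_ket (i j : ℕ) (σ : Spins) : capOp i (cupOp j (ket σ)) =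
    ∑ c, (cupWt j c σ * capWt i (ins (j / 2 + 1) c σ)) •
      ket (del (i / 2 + 1) (ins (j / 2 + 1) c σ)) := by
  rw [cupOp_ket, map_sum]
  exact Finset.sum_congr rfl fun c _ => by rw [map_smul, capOp_ket, smul_smul]

theorem cupOp_capOp_ket (i j : ℕ) (σ : Spins) : cupOp i (capOp j (ket σ)) =
    ∑ c, (capWt j σ * cupWt i c (del (j / 2 + 1) σ)) •
      ket (ins (i / 2 + 1) c (del (j / 2 + 1) σ)) := by
  rw [capOp_ket, map_smul, cupOp_ket, Finset.smul_sum]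
  exact Finset.sum_congr rfl fun c _ => by rw [smul_smul]

theorem op_loop (i : ℕ) : capOp i * cupOp i = algebraMap ℂ _ loopValue := by
  refine end_ext fun σ => ?_
  rw [Module.End.mul_apply, capOp_cupOp_ket, Module.algebraMap_end_apply]
  simp only [del_ins, ← Finset.sum_smul]
  congr 1
  rcases Nat.mod_two_eq_zero_or_one i with h | h
  · have : ∀ c, cupWt i c σ * capWt i (ins (i / 2 + 1) c σ) =
        if σ (i / 2) = c then loopValue else 0 := by
      intro c
      by_cases hc : σ (i / 2) = c <;> simp [cupWt, capWt, ins, h, hc, ← fourthRoot_mul_self]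
    simp [this]
  · have : ∀ c, cupWt i c σ * capWt i (ins (i / 2 + 1) c σ) = fourthRoot⁻¹ * fourthRoot⁻¹ := by
      intro c
      simp [cupWt, capWt, h]
    simp only [this, Finset.sum_const, Finset.card_univ, Fintype.card_fin, nsmul_eq_mul]
    have h1 := loopValue_mul_self
    rw [← fourthRoot_mul_self] at h1 ⊢
    field_simp [fourthRoot_ne_zero]
    push_cast
    rw [← h1]
    ring

theorem op_zig (i : ℕ) : capOp i * cupOp (i + 1) = 1 := by
  refine end_ext fun σ => ?_
  rw [Module.End.mul_apply, capOp_cupOp_ket, Module.End.one_apply]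
  rcases Nat.mod_two_eq_zero_or_one i with h | h
  · have h1 : (i + 1) % 2 = 1 := by omega
    have h2 : (i + 1) / 2 = i / 2 := by omega
    simp [cupWt, capWt, h, h1, h2, del_ins, ins, fourthRoot_ne_zero]
  · have h1 : (i + 1) % 2 = 0 := by omega
    have h2 : (i + 1) / 2 = i / 2 + 1 := by omega
    have h3 : ∀ σ : Spins, del (i / 2 + 1) (ins (i / 2 + 1 + 1) (σ (i / 2 + 1)) σ) = σ := by
      intro σ; funext j; simp only [del, ins]; grind
    simp [cupWt, capWt, h, h1, h2, ite_smul, h3, fourthRoot_ne_zero]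

theorem op_zag (i : ℕ) : capOp (i + 1) * cupOp i = 1 := by
  refine end_ext fun σ => ?_
  rw [Module.End.mul_apply, capOp_cupOp_ket, Module.End.one_apply]
  rcases Nat.mod_two_eq_zero_or_one i with h | h
  · have h1 : (i + 1) % 2 = 1 := by omega
    have h2 : (i + 1) / 2 = i / 2 := by omega
    simp [cupWt, capWt, h, h1, h2, del_ins, fourthRoot_ne_zero]
  · have h1 : (i + 1) % 2 = 0 := by omega
    have h2 : (i + 1) / 2 = i / 2 + 1 := by omega
    have h3 : ∀ σ : Spins, del (i / 2 + 1 + 1) (ins (i / 2 + 1) (σ (i / 2 + 1)) σ) = σ :=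
      fun σ => del_succ_ins _ _
    simp [cupWt, capWt, h, h1, h2, ite_smul, ins, h3, fourthRoot_ne_zero]

theorem op_cup_cup {i j : ℕ} (h : i ≤ j) : cupOp (j + 2) * cupOp i = cupOp i * cupOp j := by
  have h1 : (j + 2) % 2 = j % 2 := by omega
  have h2 : (j + 2) / 2 = j / 2 + 1 := by omega
  have h3 : i / 2 ≤ j / 2 := by omega
  refine end_ext fun σ => ?_
  simp only [Module.End.mul_apply, cupOp_ket, map_sum, map_smul, Finset.smul_sum, smul_smul]
  rw [Finset.sum_comm]
  refine Finset.sum_congr rfl fun d _ => Finset.sum_congr rfl fun c _ => ?_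
  rw [h2, ins_ins (by omega)]
  congr 1
  simp only [cupWt, h1, h2, ins]
  grind

theorem op_cap_cap {i j : ℕ} (h : i ≤ j) : capOp i * capOp (j + 2) = capOp j * capOp i := by
  have h1 : (j + 2) % 2 = j % 2 := by omega
  have h2 : (j + 2) / 2 = j / 2 + 1 := by omega
  have h3 : i / 2 ≤ j / 2 := by omega
  refine end_ext fun σ => ?_
  simp only [Module.End.mul_apply, capOp_ket, map_smul, smul_smul]
  rw [h2, del_del (by omega)]
  congr 1
  simp only [capWt, h1, h2, del]
  grind

theorem op_cap_cup {i j : ℕ} (h : i ≤ j) : capOp i * cupOp (j + 2) = cupOp j * capOp i := by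
  have h1 : (j + 2) % 2 = j % 2 := by omega
  have h2 : (j + 2) / 2 = j / 2 + 1 := by omega
  have h3 : i / 2 ≤ j / 2 := by omega
  refine end_ext fun σ => ?_
  rw [Module.End.mul_apply, Module.End.mul_apply, capOp_cupOp_ket, cupOp_capOp_ket]
  refine Finset.sum_congr rfl fun c _ => ?_
  rw [h2, del_ins_of_le (by omega)]
  congr 1
  simp only [capWt, cupWt, h1, h2, del, ins]
  grind

theorem op_cap_cup' {i j : ℕ} (h : i ≤ j) : capOp (j + 2) * cupOp i = cupOp i * capOp j := by
  have h1 : (j + 2) % 2 = j % 2 := by omega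
  have h2 : (j + 2) / 2 = j / 2 + 1 := by omega
  have h3 : i / 2 ≤ j / 2 := by omega
  refine end_ext fun σ => ?_
  rw [Module.End.mul_apply, Module.End.mul_apply, capOp_cupOp_ket, cupOp_capOp_ket]
  refine Finset.sum_congr rfl fun c _ => ?_
  rw [h2, del_ins_of_le' (by omega)]
  congr 1
  simp only [capWt, cupWt, h1, h2, del, ins]
  grind

/-- The representation of diagrams by operators on colourings. -/
noncomputable def rep : TL →ₐ[ℂ] Module.End ℂ (Spins →₀ ℂ) :=
  lift (fun g => match g with
    | .cup i => cupOp i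
    | .cap i => capOp i) (by
    intro _ _ h
    cases h <;> simp only [map_mul, map_one, lift_fgen, AlgHom.commutes]
    case loop i => exact op_loop _
    case zig i => exact op_zig _
    case zag i => exact op_zag _
    case cup_cup i j h => exact op_cup_cup h
    case cap_cap i j h => exact op_cap_cap h
    case cap_cup i j h => exact op_cap_cup h
    case cap_cup' i j h => exact op_cap_cup' h)

theorem rep_cup (i : ℕ) : rep (cup i) = cupOp i := by rw [rep, cup, lift_mk, lift_fgen]
theorem rep_cap (i : ℕ) : rep (cap i) = capOp i := by rw [rep, cap, lift_mk, lift_fgen]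

/-- The inner product for which the colourings are orthonormal. -/
noncomputable def spinInner (φ ψ : Spins →₀ ℂ) : ℂ := ψ.sum fun σ a => conj (φ σ) * a

theorem spinInner_add_right (φ ψ ψ' : Spins →₀ ℂ) :
    spinInner φ (ψ + ψ') = spinInner φ ψ + spinInner φ ψ' := by
  rw [spinInner, Finsupp.sum_add_index'] <;> simp [spinInner, mul_add]

theorem spinInner_smul_right (c : ℂ) (φ ψ : Spins →₀ ℂ) :
    spinInner φ (c • ψ) = c * spinInner φ ψ := by
  rw [spinInner, Finsupp.sum_smul_index' (by simp), spinInner, Finsupp.mul_sum]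
  exact Finsupp.sum_congr fun σ _ => by rw [smul_eq_mul]; ring

theorem spinInner_add_left (φ φ' ψ : Spins →₀ ℂ) :
    spinInner (φ + φ') ψ = spinInner φ ψ + spinInner φ' ψ := by
  simp [spinInner, add_mul, Finsupp.sum_add]

theorem spinInner_smul_left (c : ℂ) (φ ψ : Spins →₀ ℂ) :
    spinInner (c • φ) ψ = conj c * spinInner φ ψ := by
  simp [spinInner, Finsupp.mul_sum, mul_assoc]

open Classical in
theorem spinInner_ket (σ τ : Spins) : spinInner (ket σ) (ket τ) = if σ = τ then 1 else 0 := by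
  by_cases h : σ = τ <;> simp [spinInner, Finsupp.single_apply, h]

theorem spinInner_self (φ : Spins →₀ ℂ) :
    spinInner φ φ = ((φ.sum fun _ a => ‖a‖ ^ 2 : ℝ) : ℂ) := by
  rw [spinInner, Finsupp.sum, Finsupp.sum, Complex.ofReal_sum]
  refine Finset.sum_congr rfl fun σ _ => ?_
  rw [Complex.conj_mul']
  norm_cast

theorem spin_induction {C : (Spins →₀ ℂ) → Prop} (ket' : ∀ σ, C (ket σ))
    (smul : ∀ (c : ℂ) φ, C φ → C (c • φ)) (add : ∀ φ ψ, C φ → C ψ → C (φ + ψ)) (φ) : C φ := by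
  induction φ using Finsupp.induction_linear with
  | zero => simpa using smul 0 _ (ket' fun _ => 0)
  | add f g hf hg => exact add f g hf hg
  | single σ a => simpa using smul a _ (ket' σ)

theorem spinInner_zero_right (φ : Spins →₀ ℂ) : spinInner φ 0 = 0 := by
  simp [spinInner]

theorem spinInner_sum_right {ι : Type*} (s : Finset ι) (φ : Spins →₀ ℂ) (f : ι → Spins →₀ ℂ) :
    spinInner φ (∑ c ∈ s, f c) = ∑ c ∈ s, spinInner φ (f c) := by
  induction s using Finset.cons_induction with
  | empty => simp [spinInner]
  | cons a s h ih => rw [Finset.sum_cons, Finset.sum_cons, spinInner_add_right, ih]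

theorem spinInner_conj (φ ψ : Spins →₀ ℂ) : conj (spinInner φ ψ) = spinInner ψ φ := by
  induction φ using spin_induction with
  | ket' σ =>
    induction ψ using spin_induction with
    | ket' τ =>
      rw [spinInner_ket, spinInner_ket]
      by_cases h : σ = τ
      · simp [h]
      · simp [h, Ne.symm h]
    | smul c ψ ih => rw [spinInner_smul_left, spinInner_smul_right, map_mul, ih]
    | add ψ ψ' h h' => rw [spinInner_add_left, spinInner_add_right, map_add, h, h']
  | smul c ψ ih => rw [spinInner_smul_left, spinInner_smul_right, map_mul, ih, Complex.conj_conj]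
  | add ψ ψ' h h' => rw [spinInner_add_left, spinInner_add_right, map_add, h, h']

open Classical in
theorem spinInner_capOp (i : ℕ) (φ ψ : Spins →₀ ℂ) :
    spinInner (capOp i φ) ψ = spinInner φ (cupOp i ψ) := by
  induction φ using spin_induction with
  | ket' σ =>
    induction ψ using spin_induction with
    | ket' τ =>
      rw [capOp_ket, cupOp_ket, spinInner_smul_left, spinInner_ket, spinInner_sum_right]
      simp only [spinInner_smul_right, spinInner_ket]
      have hk : ∀ c, (cupWt i c τ * if σ = ins (i / 2 + 1) c τ then 1 else 0) =
          if c = σ (i / 2 + 1) then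
            (if del (i / 2 + 1) σ = τ then conj (capWt i σ) else 0) else 0 := by
        intro c
        by_cases h : σ = ins (i / 2 + 1) c τ
        · have h1 : c = σ (i / 2 + 1) := by rw [h]; simp [ins]
          have h2 : del (i / 2 + 1) σ = τ := by rw [h, del_ins]
          rw [if_pos h, if_pos h1, if_pos h2, mul_one]
          have h3 : τ (i / 2) = σ (i / 2) := by rw [h]; simp [ins]
          rw [cupWt, capWt, h3, h1]
          split_ifs <;> simp [conj_fourthRoot]
        · rw [if_neg h, mul_zero]
          split_ifs with h1 h2
          · exact absurd (by rw [h1, ← h2, ins_del]) h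
          · rfl
          · rfl
      rw [Finset.sum_congr rfl fun c _ => hk c]
      simp
    | smul c ψ ih => simp only [map_smul, spinInner_smul_right, ih]
    | add ψ ψ' h h' => simp only [map_add, spinInner_add_right, h, h']
  | smul c ψ ih => simp only [map_smul, spinInner_smul_left, ih]
  | add ψ ψ' h h' => simp only [map_add, spinInner_add_left, h, h']

theorem spinInner_cupOp (i : ℕ) (φ ψ : Spins →₀ ℂ) :
    spinInner (cupOp i φ) ψ = spinInner φ (capOp i ψ) := by
  rw [← spinInner_conj, ← spinInner_capOp, spinInner_conj]

/-- The representation on colourings turns the adjoint of diagrams into that of operators. -/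
theorem spinInner_rep (x : TL) : ∀ φ ψ : Spins →₀ ℂ,
    spinInner (rep x φ) ψ = spinInner φ (rep (star x) ψ) := by
  induction x using TL.induction with
  | scalar c =>
    intro φ ψ
    rw [star_def, ← star_def, star_algebraMap', AlgHom.commutes, AlgHom.commutes]
    simp only [Module.algebraMap_end_apply, spinInner_smul_left, spinInner_smul_right]
  | cup_mul i x ih =>
    intro φ ψ
    rw [star_mul, map_mul, map_mul, Module.End.mul_apply, Module.End.mul_apply, star_cup, rep_cup,
      rep_cap, spinInner_cupOp, ih]
  | cap_mul i x ih =>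
    intro φ ψ
    rw [star_mul, map_mul, map_mul, Module.End.mul_apply, Module.End.mul_apply, star_cap, rep_cup,
      rep_cap, spinInner_capOp, ih]
  | smul c x ih =>
    intro φ ψ
    rw [star_smul, map_smul, map_smul, LinearMap.smul_apply, LinearMap.smul_apply,
      spinInner_smul_left, spinInner_smul_right, ih]; rfl
  | add x y hx hy =>
    intro φ ψ
    rw [star_add, map_add, map_add, LinearMap.add_apply, LinearMap.add_apply,
      spinInner_add_left, spinInner_add_right, hx, hy]

/-! ### Cables, the trivalent vertex, and trees as diagrams -/

/-- The second Jones–Wenzl idempotent `1 - δ⁻¹ · cup · cap` on the strings `i`, `i + 1`. -/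
noncomputable def jw (i : ℕ) : TL := 1 - loopValue⁻¹ • (cup i * cap i)

theorem jw_mul_cup (i : ℕ) : jw i * cup i = 0 := by
  rw [jw, sub_mul, one_mul, smul_mul_assoc, mul_assoc, cap_mul_cup_self, ← Algebra.commutes,
    ← Algebra.smul_def, smul_smul, inv_mul_cancel₀ loopValue_ne_zero, one_smul, sub_self]

theorem jw_mul_jw (i : ℕ) : jw i * jw i = jw i := by
  conv_lhs => rw [show jw i * jw i = jw i * (1 - loopValue⁻¹ • (cup i * cap i)) from rfl]
  rw [mul_sub, mul_one, mul_smul_comm, ← mul_assoc, jw_mul_cup, zero_mul, smul_zero, sub_zero]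

theorem star_jw (i : ℕ) : star (jw i) = jw i := by
  rw [jw, star_sub, star_one, star_smul, star_mul, star_cup, star_cap, star_inv₀]
  congr 3
  exact conj_loopValue

theorem shift_jw (i : ℕ) : shift (jw i) = jw (i + 2) := by
  rw [jw, jw, map_sub, map_one, map_smul, map_mul, shift_cup, shift_cap]

theorem cap_mul_shift (x : TL) : cap 0 * shift x = x * cap 0 := by
  induction x using TL.induction with
  | scalar c => rw [AlgHom.commutes, Algebra.commutes]
  | cup_mul i x ih =>
    rw [map_mul, shift_cup, ← mul_assoc, cap_mul_cup (Nat.zero_le _), mul_assoc, ih, mul_assoc]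
  | cap_mul i x ih =>
    rw [map_mul, shift_cap, ← mul_assoc, cap_mul_cap (Nat.zero_le _), mul_assoc, ih, mul_assoc]
  | smul c x ih => rw [map_smul, mul_smul_comm, ih, smul_mul_assoc]
  | add x y hx hy => rw [map_add, mul_add, hx, hy, add_mul]

theorem shift_mul_cup (x : TL) : shift x * cup 0 = cup 0 * x := by
  have := congrArg star (cap_mul_shift (star x))
  simpa [star_mul, star_cap, star_shift] using this

theorem jw_mul_shift (x : TL) : jw 0 * shift x = shift x * jw 0 := by
  rw [jw, sub_mul, mul_sub, one_mul, mul_one, smul_mul_assoc, mul_smul_comm, mul_assoc,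
    cap_mul_shift, ← mul_assoc, ← mul_assoc, shift_mul_cup]

theorem cup_one_mul_shift (x : TL) : cup 1 * shift x = shift (shift x) * cup 1 := by
  induction x using TL.induction with
  | scalar c => rw [AlgHom.commutes, AlgHom.commutes, Algebra.commutes]
  | cup_mul i x ih =>
    rw [map_mul, map_mul, shift_cup, shift_cup, ← mul_assoc, ← cup_mul_cup (by omega), mul_assoc,
      ih, mul_assoc]
  | cap_mul i x ih =>
    rw [map_mul, map_mul, shift_cap, shift_cap, ← mul_assoc, ← cap_mul_cup' (by omega), mul_assoc,
      ih, mul_assoc]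
  | smul c x ih => rw [map_smul, map_smul, mul_smul_comm, ih, smul_mul_assoc]
  | add x y hx hy => rw [map_add, map_add, mul_add, hx, hy, add_mul]

/-- The normalised trivalent vertex, `3 ^ (1/4)` times the diagram in which the second
Jones–Wenzl idempotent is put on the three legs of a vertex made of one cup. -/
noncomputable def trivalent : TL := fourthRoot • (jw 0 * jw 2 * cup 1 * jw 0)

theorem jw_two : jw 2 = shift (jw 0) := (shift_jw 0).symm

theorem jw_zero_mul_jw_two : jw 0 * jw 2 = jw 2 * jw 0 := by rw [jw_two, jw_mul_shift]

theorem star_trivalent : star trivalent = fourthRoot • (jw 0 * cap 1 * (jw 0 * jw 2)) := by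
  rw [trivalent, star_smul, star_mul, star_mul, star_mul, star_jw, star_jw, star_cup,
    jw_zero_mul_jw_two, show star fourthRoot = fourthRoot from conj_fourthRoot]
  simp only [mul_assoc]

theorem trivalent_mul_jw : trivalent * jw 0 = trivalent := by
  rw [trivalent, smul_mul_assoc, mul_assoc _ (jw 0), jw_mul_jw]

theorem jw_zero_mul_trivalent : jw 0 * trivalent = trivalent := by
  rw [trivalent, mul_smul_comm, ← mul_assoc, ← mul_assoc, ← mul_assoc, jw_mul_jw]

theorem jw_two_mul_trivalent : jw 2 * trivalent = trivalent := by
  rw [trivalent, jw_zero_mul_jw_two, mul_smul_comm, ← mul_assoc, ← mul_assoc, ← mul_assoc,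
    jw_mul_jw]

theorem trivalent_mul_shift (x : TL) : trivalent * shift x = shift (shift x) * trivalent := by
  rw [trivalent, smul_mul_assoc, mul_smul_comm, mul_assoc, jw_mul_shift, mul_assoc (jw 0 * jw 2),
    ← mul_assoc (cup 1), cup_one_mul_shift, jw_two, mul_assoc (jw 0), mul_assoc (shift _),
    ← mul_assoc (shift (jw 0)), ← map_mul, jw_mul_shift, map_mul, mul_assoc (shift (shift x)),
    ← mul_assoc (jw 0) (shift _), jw_mul_shift]
  simp only [mul_assoc]

theorem cap_jw_jw_cup : cap 1 * (jw 0 * jw 2) * cup 1 =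
    (loopValue - 2 * loopValue⁻¹) • (1 : TL) + (loopValue⁻¹ * loopValue⁻¹) • (cup 0 * cap 0) := by
  have h0 : cap 1 * cup 1 = loopValue • (1 : TL) := by
    rw [cap_mul_cup_self, Algebra.algebraMap_eq_smul_one]
  have h1 : cap 1 * (cup 0 * cap 0) * cup 1 = 1 := by
    rw [← mul_assoc, zag 0, one_mul, zig 0]
  have h2 : cap 1 * (cup 2 * cap 2) * cup 1 = 1 := by
    rw [← mul_assoc, zig 1, one_mul, zag 1]
  have h3 : cap 1 * ((cup 0 * cap 0) * (cup 2 * cap 2)) * cup 1 = cup 0 * cap 0 := by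
    have z0 : cap 1 * cup 0 = 1 := zag 0
    have z1 : cap 2 * cup 1 = 1 := zag 1
    have z2 : cap 0 * cup 2 = cup 0 * cap 0 := cap_mul_cup le_rfl
    have : cap 1 * ((cup 0 * cap 0) * (cup 2 * cap 2)) * cup 1 =
        (cap 1 * cup 0) * (cap 0 * cup 2) * (cap 2 * cup 1) := by simp only [mul_assoc]
    rw [this, z0, z1, z2, one_mul, mul_one]
  have : cap 1 * (jw 0 * jw 2) * cup 1 = cap 1 * cup 1 -
      loopValue⁻¹ • (cap 1 * (cup 0 * cap 0) * cup 1) -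
      loopValue⁻¹ • (cap 1 * (cup 2 * cap 2) * cup 1) +
      (loopValue⁻¹ * loopValue⁻¹) • (cap 1 * ((cup 0 * cap 0) * (cup 2 * cap 2)) * cup 1) := by
    simp only [jw, sub_mul, mul_sub, one_mul, mul_one, smul_mul_assoc, mul_smul_comm]
    module
  rw [this, h0, h1, h2, h3]
  module

theorem star_trivalent_mul_trivalent : star trivalent * trivalent = jw 0 := by
  have h : star trivalent * trivalent =
      (fourthRoot * fourthRoot) • (jw 0 * (cap 1 * (jw 0 * jw 2) * cup 1) * jw 0) := by
    rw [star_trivalent, smul_mul_assoc]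
    have : (jw 0 * cap 1 * (jw 0 * jw 2)) * trivalent = jw 0 * cap 1 * trivalent := by
      rw [mul_assoc, mul_assoc (jw 0) (jw 2), jw_two_mul_trivalent, jw_zero_mul_trivalent]
    rw [this, trivalent, mul_smul_comm, smul_smul]
    simp only [mul_assoc]
  rw [h, cap_jw_jw_cup, fourthRoot_mul_self, mul_add, mul_smul_comm, mul_smul_comm, mul_one,
    ← mul_assoc, jw_mul_cup, zero_mul, smul_zero, add_zero, smul_mul_assoc, jw_mul_jw, smul_smul]
  have : loopValue * (loopValue - 2 * loopValue⁻¹) = 1 := by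
    have h1 := loopValue_mul_self
    have h2 := loopValue_ne_zero
    field_simp
    rw [sq, h1]; norm_num
  rw [this, one_smul]

/-- `n` cables, of two strings each, are added on the left. -/
noncomputable def shiftBy : ℕ → (TL →ₐ[ℂ] TL)
  | 0 => AlgHom.id ℂ TL
  | n + 1 => shift.comp (shiftBy n)

/-- `n` parallel cables, with the second Jones–Wenzl idempotent on each. -/
noncomputable def proj : ℕ → TL
  | 0 => 1
  | n + 1 => jw 0 * shift (proj n)

/-- A tree as a diagram with one input cable and one output cable for each leaf: every vertex of
the tree is replaced by the trivalent vertex. -/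
noncomputable def tree : BTree → TL
  | .leaf => jw 0
  | .node l r => shiftBy l.leaves (tree r) * tree l * trivalent

/-- A forest as a diagram: its trees side by side. -/
noncomputable def forestMap : List BTree → TL
  | [] => 1
  | t :: fs => shiftBy t.leaves (forestMap fs) * tree t

theorem shiftBy_add (m n : ℕ) (x : TL) : shiftBy (m + n) x = shiftBy m (shiftBy n x) := by
  induction m with
  | zero => simp [shiftBy]
  | succ m ih => rw [Nat.succ_add]; simp [shiftBy, ih]

theorem shiftBy_shift (n : ℕ) (x : TL) : shiftBy n (shift x) = shiftBy (n + 1) x := by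
  rw [shiftBy_add]; rfl

theorem star_shiftBy (n : ℕ) (x : TL) : star (shiftBy n x) = shiftBy n (star x) := by
  induction n with
  | zero => rfl
  | succ n ih => simp [shiftBy, star_shift, ih]

theorem proj_add (m n : ℕ) : proj (m + n) = shiftBy m (proj n) * proj m := by
  induction m with
  | zero => simp [proj, shiftBy]
  | succ m ih =>
    rw [Nat.succ_add, proj, ih, proj, map_mul, shiftBy, AlgHom.comp_apply, ← mul_assoc,
      jw_mul_shift, mul_assoc]

theorem proj_mul_shiftBy (n : ℕ) (x : TL) : proj n * shiftBy n x = shiftBy n x * proj n := by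
  induction n with
  | zero => simp [proj]
  | succ n ih =>
    rw [proj, shiftBy, AlgHom.comp_apply, mul_assoc, ← map_mul, ih, map_mul, ← mul_assoc,
      jw_mul_shift, mul_assoc]

theorem proj_one : proj 1 = jw 0 := by simp [proj]

theorem tree_mul_shift (t : BTree) (x : TL) : tree t * shift x = shiftBy t.leaves x * tree t := by
  induction t generalizing x with
  | leaf => exact jw_mul_shift x
  | node l r hl hr =>
    rw [tree, mul_assoc, trivalent_mul_shift, mul_assoc, ← mul_assoc (tree l), hl, ← mul_assoc,
      ← mul_assoc, ← map_mul, hr, map_mul, leaves, shiftBy_add]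
    simp only [mul_assoc]

theorem tree_mul_jw (t : BTree) : tree t * jw 0 = tree t := by
  cases t with
  | leaf => exact jw_mul_jw 0
  | node l r => rw [tree, mul_assoc, trivalent_mul_jw]

theorem proj_mul_tree (t : BTree) : proj t.leaves * tree t = tree t := by
  induction t with
  | leaf => rw [leaves, proj_one]; exact jw_mul_jw 0
  | node l r hl hr =>
    rw [leaves, proj_add, tree, mul_assoc, ← mul_assoc (proj _), ← mul_assoc (proj _),
      proj_mul_shiftBy, mul_assoc (shiftBy _ (tree r)), hl, ← mul_assoc, ← mul_assoc,
      ← map_mul, hr]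

theorem star_tree_mul_tree (t : BTree) : star (tree t) * tree t = jw 0 := by
  induction t with
  | leaf => rw [tree, star_jw, jw_mul_jw]
  | node l r hl hr =>
    rw [tree, star_mul, star_mul, star_shiftBy]
    calc star trivalent * (star (tree l) * shiftBy l.leaves (star (tree r))) *
          (shiftBy l.leaves (tree r) * tree l * trivalent)
        = star trivalent * (star (tree l) *
          (shiftBy l.leaves (star (tree r) * tree r) * tree l)) * trivalent := by
          rw [map_mul]; simp only [mul_assoc]
      _ = jw 0 := by
          rw [hr, ← tree_mul_shift, ← mul_assoc (star (tree l)), hl, ← jw_two,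
            mul_assoc, mul_assoc, jw_two_mul_trivalent, jw_zero_mul_trivalent,
            star_trivalent_mul_trivalent]

theorem star_forestMap_mul (fs : List BTree) :
    star (forestMap fs) * forestMap fs = proj fs.length := by
  induction fs with
  | nil => simp [forestMap, proj]
  | cons t fs ih =>
    rw [forestMap, star_mul, star_shiftBy]
    calc star (tree t) * shiftBy t.leaves (star (forestMap fs)) *
          (shiftBy t.leaves (forestMap fs) * tree t)
        = star (tree t) *
          (shiftBy t.leaves (star (forestMap fs) * forestMap fs) * tree t) := by
          rw [map_mul]; simp only [mul_assoc]
      _ = _ := by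
          rw [ih, ← tree_mul_shift, ← mul_assoc, star_tree_mul_tree]; rfl

theorem proj_mul_forestMap (fs : List BTree) :
    proj (forestLeaves fs) * forestMap fs = forestMap fs := by
  induction fs with
  | nil => simp [forestMap, proj, forestLeaves]
  | cons t fs ih =>
    rw [forestLeaves, forestMap, proj_add, mul_assoc, ← mul_assoc (proj _), proj_mul_shiftBy,
      mul_assoc (shiftBy _ (forestMap fs)), proj_mul_tree, ← mul_assoc, ← map_mul, ih]

theorem forestMap_append (fs gs : List BTree) : forestMap (fs ++ gs) =
    shiftBy (forestLeaves fs) (forestMap gs) * forestMap fs := by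
  induction fs with
  | nil => simp [forestMap, forestLeaves, shiftBy]
  | cons t fs ih =>
    rw [List.cons_append, forestMap, ih, map_mul, forestLeaves, shiftBy_add, forestMap, mul_assoc]

theorem forestMap_mul_shiftBy (fs : List BTree) (x : TL) :
    forestMap fs * shiftBy fs.length x = shiftBy (forestLeaves fs) x * forestMap fs := by
  induction fs with
  | nil => simp [forestMap, forestLeaves]
  | cons t fs ih =>
    rw [forestMap, List.length_cons, shiftBy, AlgHom.comp_apply, mul_assoc, tree_mul_shift,
      ← mul_assoc, ← map_mul, ih, map_mul, forestLeaves, shiftBy_add, mul_assoc]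

theorem forestMap_mul_tree : ∀ {t s : BTree}, t ≤ s → forestMap (t.forest s) * tree t = tree s
  | .leaf, s, _ => by simp [BTree.forest, forestMap, tree, tree_mul_jw]
  | .node _ _, .leaf, h => (BTree.not_node_le_leaf h).elim
  | .node l r, .node l' r', h => by
    rw [BTree.forest, forestMap_append, forestLeaves_forest h.1, tree, tree]
    have hc : forestMap (l.forest l') * shiftBy l.leaves (tree r) =
        shiftBy l'.leaves (tree r) * forestMap (l.forest l') := by
      rw [← length_forest h.1, forestMap_mul_shiftBy, forestLeaves_forest h.1]
    rw [← mul_assoc, ← mul_assoc, mul_assoc _ _ (shiftBy l.leaves (tree r)), hc, ← mul_assoc,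
      ← map_mul, forestMap_mul_tree h.2, mul_assoc _ _ (tree l), forestMap_mul_tree h.1]

theorem forestMap_mul_forestMap : ∀ {t s u : BTree}, t ≤ s → s ≤ u →
    forestMap (s.forest u) * forestMap (t.forest s) = forestMap (t.forest u)
  | .leaf, s, u, _, h => by
    simp [BTree.forest, forestMap, forestMap_mul_tree h]
  | .node _ _, .leaf, _, h, _ => (BTree.not_node_le_leaf h).elim
  | .node _ _, .node _ _, .leaf, _, h => (BTree.not_node_le_leaf h).elim
  | .node l r, .node l' r', .node l'' r'', h, h' => by
    have hc : forestMap (l'.forest l'') * shiftBy l'.leaves (forestMap (r.forest r')) =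
        shiftBy l''.leaves (forestMap (r.forest r')) * forestMap (l'.forest l'') := by
      rw [← length_forest h'.1, forestMap_mul_shiftBy, forestLeaves_forest h'.1]
    rw [BTree.forest, BTree.forest, BTree.forest, forestMap_append, forestMap_append,
      forestMap_append, forestLeaves_forest h.1, forestLeaves_forest h'.1,
      forestLeaves_forest (le_trans h.1 h'.1), mul_assoc, ← mul_assoc (forestMap (l'.forest l'')), hc,
      mul_assoc, forestMap_mul_forestMap h.1 h'.1, ← mul_assoc, ← map_mul,
      forestMap_mul_forestMap h.2 h'.2]

theorem forestMap_self : ∀ t : BTree, forestMap (t.forest t) = proj t.leaves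
  | .leaf => by simp [BTree.forest, forestMap, tree, leaves, proj]
  | .node l r => by
    rw [BTree.forest, forestMap_append, forestMap_self l, forestMap_self r,
      forestLeaves_forest le_rfl, leaves, proj_add]

theorem jw_mem : jw 0 ∈ Hom 2 2 :=
  sub_mem (one_mem 2) (Submodule.smul_mem _ _ (Hom.mul (cup_mem le_rfl) (cap_mem le_rfl)))

theorem jw_two_mem : jw 2 ∈ Hom 4 4 := by rw [jw_two]; exact Hom.shift jw_mem

theorem trivalent_mem : trivalent ∈ Hom 2 4 :=
  Submodule.smul_mem _ _ (Hom.mul (Hom.mul (Hom.mul (Hom.add_right 2 jw_mem) jw_two_mem)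
    (cup_mem (by norm_num))) jw_mem)

theorem Hom.shiftBy {m n : ℕ} {x : TL} (k : ℕ) (hx : x ∈ Hom m n) :
    TL.shiftBy k x ∈ Hom (m + 2 * k) (n + 2 * k) := by
  induction k with
  | zero => exact hx
  | succ k ih => exact Hom.shift ih

theorem tree_mem (t : BTree) : tree t ∈ Hom 2 (2 * t.leaves) := by
  induction t with
  | leaf => exact jw_mem
  | node l r hl hr =>
    have h1 := Hom.add_right 2 hl
    have h2 := Hom.shiftBy l.leaves hr
    have e : 2 + 2 * l.leaves = 2 * l.leaves + 2 := by ring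
    have e' : 2 * r.leaves + 2 * l.leaves = 2 * (l.leaves + r.leaves) := by ring
    rw [e, e'] at h2
    exact Hom.mul (Hom.mul h2 h1) trivalent_mem

theorem forestMap_mem (fs : List BTree) :
    forestMap fs ∈ Hom (2 * fs.length) (2 * forestLeaves fs) := by
  induction fs with
  | nil => exact one_mem 0
  | cons t fs ih =>
    have h1 := Hom.add_right (2 * fs.length) (tree_mem t)
    have h2 := Hom.shiftBy t.leaves ih
    have e1 : 2 + 2 * fs.length = 2 * (fs.length + 1) := by ring
    have e2 : 2 * fs.length + 2 * t.leaves = 2 * t.leaves + 2 * fs.length := by ring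
    have e3 : 2 * forestLeaves fs + 2 * t.leaves = 2 * (t.leaves + forestLeaves fs) := by ring
    rw [e1] at h1
    rw [e2, e3] at h2
    exact Hom.mul h2 h1

/-- The space of diagrams with one input cable and `n` output cables, with the second
Jones–Wenzl idempotent on every cable. -/
noncomputable def cableHom (n : ℕ) : Submodule ℂ TL where
  carrier := {x | x ∈ Hom 2 (2 * n) ∧ proj n * x = x ∧ x * jw 0 = x}
  zero_mem' := ⟨zero_mem _, mul_zero _, zero_mul _⟩
  add_mem' := fun hx hy => ⟨add_mem hx.1 hy.1, by rw [mul_add, hx.2.1, hy.2.1],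
    by rw [add_mul, hx.2.2, hy.2.2]⟩
  smul_mem' := fun c _ hx => ⟨Submodule.smul_mem _ c hx.1, by rw [mul_smul_comm, hx.2.1],
    by rw [smul_mul_assoc, hx.2.2]⟩

theorem forestMap_mul_mem {t s : BTree} (h : t ≤ s) {x : TL} (hx : x ∈ cableHom t.leaves) :
    forestMap (t.forest s) * x ∈ cableHom s.leaves := by
  have h1 := forestMap_mem (t.forest s)
  have h2 := proj_mul_forestMap (t.forest s)
  rw [length_forest h, forestLeaves_forest h] at h1
  rw [forestLeaves_forest h] at h2
  exact ⟨Hom.mul h1 hx.1, by rw [← mul_assoc, h2], by rw [mul_assoc, hx.2.2]⟩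

open Classical in
/-- The number `c` such that `x` is `c` times a cable (with the idempotent on it). -/
noncomputable def scalar (x : TL) : ℂ := if h : ∃ c : ℂ, x = c • jw 0 then h.choose else 0

theorem rep_jw_ket : rep (jw 0) (ket fun j => if j = 0 then 0 else 1) =
    ket fun j => if j = 0 then 0 else 1 := by
  rw [jw, map_sub, map_one, map_smul, map_mul, rep_cup, rep_cap, LinearMap.sub_apply,
    LinearMap.smul_apply, Module.End.mul_apply, capOp_ket]
  simp [capWt]

theorem spinInner_jw (c : ℂ) : spinInner (ket fun j => if j = 0 then 0 else 1)
    (rep (c • jw 0) (ket fun j => if j = 0 then 0 else 1)) = c := by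
  rw [map_smul, LinearMap.smul_apply, rep_jw_ket, spinInner_smul_right, spinInner_ket]
  simp

theorem scalar_smul (c : ℂ) : scalar (c • jw 0) = c := by
  have h : ∃ d : ℂ, c • jw 0 = d • jw 0 := ⟨c, rfl⟩
  rw [scalar, dif_pos h]
  have e := congrArg (fun x => spinInner (ket fun j => if j = 0 then 0 else 1)
    (rep x (ket fun j => if j = 0 then 0 else 1))) h.choose_spec
  simp only [spinInner_jw] at e
  exact e.symm

theorem exists_scalar {n : ℕ} {x y : TL} (hx : x ∈ cableHom n) (hy : y ∈ cableHom n) :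
    ∃ c : ℂ, star x * y = c • jw 0 := by
  obtain ⟨a, b, h⟩ := Hom.two_two (Hom.mul (Hom.star hx.1) hy.1)
  refine ⟨a, ?_⟩
  have e : star x * y = jw 0 * (star x * y) * jw 0 := by
    rw [mul_assoc, mul_assoc, hy.2.2, ← mul_assoc]
    congr 1
    have := congrArg star hx.2.2
    rwa [star_mul, star_jw, eq_comm] at this
  rw [e, h, mul_add, add_mul, mul_smul_comm, mul_smul_comm, mul_one, smul_mul_assoc, jw_mul_jw,
    ← mul_assoc, jw_mul_cup, zero_mul, smul_zero, zero_mul, add_zero]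

/-- The inner product `⟨x, y⟩` of two diagrams with one input cable and `n` output cables: the
number `c` such that `x* y` is `c` times a cable.  (Conjugate linear in `x`.) -/
noncomputable def cableInner (x y : TL) : ℂ := scalar (star x * y)

theorem star_mul_eq {n : ℕ} {x y : TL} (hx : x ∈ cableHom n) (hy : y ∈ cableHom n) :
    star x * y = cableInner x y • jw 0 := by
  obtain ⟨c, h⟩ := exists_scalar hx hy
  rw [cableInner, h, scalar_smul]

theorem inner_eq {n : ℕ} {x y : TL} (hx : x ∈ cableHom n) (hy : y ∈ cableHom n) :
    cableInner x y = spinInner (rep x (ket fun j => if j = 0 then 0 else 1))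
      (rep y (ket fun j => if j = 0 then 0 else 1)) := by
  rw [spinInner_rep, ← Module.End.mul_apply, ← map_mul, star_mul_eq hx hy, spinInner_jw]

theorem inner_forestMap_mul {t s : BTree} (h : t ≤ s) {x y : TL} (hy : y ∈ cableHom t.leaves) :
    cableInner (forestMap (t.forest s) * x) (forestMap (t.forest s) * y) = cableInner x y := by
  rw [cableInner, cableInner, star_mul, mul_assoc, ← mul_assoc _ _ y, star_forestMap_mul, length_forest h,
    hy.2.1]

end TL

/-! ### The Hilbert space and the unitary representation of `F` -/

open TL

noncomputable instance : DecidableEq BTree := Classical.decEq _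

/-- For `t ≤ s`, the inclusion of the space of the partition of `t` in that of the partition of
`s`: the forest that refines `t` to `s`, with trivalent vertices, is put on the outputs. -/
noncomputable def transition (t s : BTree) (h : t ≤ s) :
    cableHom t.leaves →ₗ[ℂ] cableHom s.leaves where
  toFun x := ⟨forestMap (t.forest s) * x, forestMap_mul_mem h x.2⟩
  map_add' _ _ := Subtype.ext (mul_add _ _ _)
  map_smul' _ _ := Subtype.ext (mul_smul_comm _ _ _)

instance : DirectedSystem (fun t : BTree => cableHom t.leaves) (fun t s h => transition t s h) where
  map_self t x := Subtype.ext (by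
    change forestMap (t.forest t) * (x : TL) = x
    rw [forestMap_self, x.2.2.1])
  map_map u s t h h' x := Subtype.ext (by
    change forestMap (s.forest u) * (forestMap (t.forest s) * (x : TL)) = _
    rw [← mul_assoc, forestMap_mul_forestMap h h']; rfl)

/-- The direct limit, over all standard dyadic partitions, of the spaces of diagrams with one
input cable and one output cable for each interval. -/
abbrev Limit : Type := Module.DirectLimit (fun t : BTree => cableHom t.leaves) transition

/-- The class in the direct limit of a diagram on the partition of `t`. -/
noncomputable def toLimit (t : BTree) : cableHom t.leaves →ₗ[ℂ] Limit :=
  Module.DirectLimit.of ℂ BTree _ transition t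

theorem toLimit_transition {t s : BTree} (h : t ≤ s) (x : cableHom t.leaves) :
    toLimit s (transition t s h x) = toLimit t x := Module.DirectLimit.of_f

theorem exists_toLimit (z : Limit) : ∃ t x, toLimit t x = z := Module.DirectLimit.exists_of z

theorem exists_toLimit₂ (z w : Limit) : ∃ t x y, toLimit t x = z ∧ toLimit t y = w :=
  Module.DirectLimit.exists_of₂ z w

theorem toLimit_eq {t s : BTree} {x : cableHom t.leaves} {y : cableHom s.leaves}
    (h : toLimit t x = toLimit s y) :
    ∃ u, ∃ (ht : t ≤ u) (hs : s ≤ u), transition t u ht x = transition s u hs y := by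
  obtain ⟨u, ht, hs⟩ := exists_ge_ge t s
  rw [← toLimit_transition ht, ← toLimit_transition hs] at h
  obtain ⟨v, hv, e⟩ := Module.DirectLimit.exists_eq_of_of_eq h
  refine ⟨v, ht.trans hv, hs.trans hv, ?_⟩
  have e1 := DirectedSystem.map_map' (fun t s h => transition t s h) ht hv x
  have e2 := DirectedSystem.map_map' (fun t s h => transition t s h) hs hv y
  rw [← e1, ← e2, e]

/-- The inner product of the direct limit, computed on any partition on which both vectors are
represented. -/
noncomputable def limitInner (z w : Limit) : ℂ :=
  TL.cableInner ((exists_toLimit₂ z w).choose_spec.choose : TL)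
    ((exists_toLimit₂ z w).choose_spec.choose_spec.choose : TL)

theorem inner_transition {t s : BTree} (h : t ≤ s) (x y : cableHom t.leaves) :
    TL.cableInner (transition t s h x : TL) (transition t s h y : TL) = TL.cableInner (x : TL) (y : TL) :=
  inner_forestMap_mul h y.2

theorem limitInner_toLimit (t : BTree) (x y : cableHom t.leaves) :
    limitInner (toLimit t x) (toLimit t y) = TL.cableInner (x : TL) (y : TL) := by
  have H := exists_toLimit₂ (toLimit t x) (toLimit t y)
  obtain ⟨h1, h2⟩ := H.choose_spec.choose_spec.choose_spec
  change TL.cableInner (H.choose_spec.choose : TL) (H.choose_spec.choose_spec.choose : TL) = _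
  generalize H.choose_spec.choose_spec.choose = y' at h1 h2 ⊢
  generalize H.choose_spec.choose = x' at h1 h2 ⊢
  generalize H.choose = s at x' y' h1 h2 ⊢
  obtain ⟨u, hs, ht, e1⟩ := toLimit_eq h1
  rw [← toLimit_transition hs, ← toLimit_transition ht] at h2
  obtain ⟨v, hv, _, e2⟩ := toLimit_eq h2
  have e1' := congrArg (transition u v hv) e1
  rw [← inner_transition hs, ← inner_transition hv, e1, e2, inner_transition, inner_transition]

@[reducible]
noncomputable def limitCore : PreInnerProductSpace.Core ℂ Limit where
  inner := limitInner
  conj_inner_symm z w := by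
    obtain ⟨t, x, y, rfl, rfl⟩ := exists_toLimit₂ z w
    rw [limitInner_toLimit, limitInner_toLimit, inner_eq x.2 y.2, inner_eq y.2 x.2,
      spinInner_conj]
  re_inner_nonneg z := by
    obtain ⟨t, x, rfl⟩ := exists_toLimit z
    rw [limitInner_toLimit, inner_eq x.2 x.2, spinInner_self]
    exact Finset.sum_nonneg fun _ _ => sq_nonneg _
  add_left z z' w := by
    obtain ⟨t, x, x', rfl, rfl⟩ := exists_toLimit₂ z z'
    obtain ⟨s, y, rfl⟩ := exists_toLimit w
    obtain ⟨u, ht, hs⟩ := exists_ge_ge t s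
    have e : (transition t u ht (x + x') : TL) = transition t u ht x + transition t u ht x' :=
      mul_add _ _ _
    rw [← toLimit_transition ht x, ← toLimit_transition ht x', ← toLimit_transition hs y,
      ← map_add, ← map_add, limitInner_toLimit, limitInner_toLimit, limitInner_toLimit,
      inner_eq (Subtype.prop _) (Subtype.prop _), inner_eq (Subtype.prop _) (Subtype.prop _),
      inner_eq (Subtype.prop _) (Subtype.prop _), e, map_add, LinearMap.add_apply,
      spinInner_add_left]
  smul_left z w c := by
    obtain ⟨t, x, y, rfl, rfl⟩ := exists_toLimit₂ z w
    rw [← map_smul, limitInner_toLimit, limitInner_toLimit, inner_eq (c • x).2 y.2,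
      inner_eq x.2 y.2, ← spinInner_smul_left, ← LinearMap.smul_apply, ← map_smul]
    rfl

noncomputable instance : SeminormedAddCommGroup Limit :=
  @InnerProductSpace.Core.toSeminormedAddCommGroup ℂ Limit _ _ _ limitCore

noncomputable instance : InnerProductSpace ℂ Limit := InnerProductSpace.ofCore limitCore

theorem inner_toLimit (t : BTree) (x y : cableHom t.leaves) :
    Inner.inner ℂ (toLimit t x) (toLimit t y) = TL.cableInner (x : TL) (y : TL) :=
  limitInner_toLimit t x y

/-- The Hilbert space: the Hausdorff completion of the direct limit.  (The vectors of norm `0`,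
among them the negligible diagrams, become `0`.) -/
abbrev HilbertSpace : Type := UniformSpace.Completion Limit

/-- The vacuum vector: one straight cable, on the partition into the single interval `[0,1]`. -/
noncomputable def vacuumLimit : Limit := toLimit .leaf ⟨jw 0, jw_mem, by
  rw [BTree.leaves, proj_one, jw_mul_jw], jw_mul_jw 0⟩

/-- The vacuum vector of the Hilbert space. -/
noncomputable def vacuum : HilbertSpace := (vacuumLimit : Limit)

/-- The same diagram, on another partition with the same number of intervals. -/
noncomputable def relabel {s t : BTree} (h : s.leaves = t.leaves) :
    cableHom t.leaves →ₗ[ℂ] cableHom s.leaves :=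
  Submodule.inclusion (le_of_eq (by rw [h]))

theorem exists_good {g : unitInterval ≃ₜ unitInterval} (hg : g ∈ thompsonF) (z : Limit) :
    ∃ s t x, IsTreePair g s t ∧ toLimit t x = z := by
  obtain ⟨s, t, h⟩ := hg
  obtain ⟨u, x, rfl⟩ := exists_toLimit z
  obtain ⟨v, ht, hu⟩ := exists_ge_ge t u
  exact ⟨_, v, transition u v hu x, h.refine ht, toLimit_transition hu x⟩

/-- The action of `g` on the direct limit: represent the vector by a diagram on a partition that
is good for `g`, and read the same diagram on the image of this partition. -/
noncomputable def actFun (g : thompsonF) (z : Limit) : Limit :=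
  toLimit (exists_good g.2 z).choose
    (relabel (exists_good g.2 z).choose_spec.choose_spec.choose_spec.1.leaves_eq
      (exists_good g.2 z).choose_spec.choose_spec.choose)

theorem toLimit_relabel {g : unitInterval ≃ₜ unitInterval} {s t u : BTree} (h : IsTreePair g s t)
    (htu : t ≤ u) (x : cableHom t.leaves) :
    toLimit s (relabel h.leaves_eq x) =
      toLimit (s.attach (t.forest u)) (relabel (h.refine htu).leaves_eq (transition t u htu x)) := by
  rw [← toLimit_transition (le_attach s (t.forest u))]
  congr 1
  refine Subtype.ext ?_
  change forestMap (s.forest (s.attach (t.forest u))) * (x : TL) = forestMap (t.forest u) * x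
  rw [forest_attach _ _ ((length_forest htu).trans h.leaves_eq.symm)]

theorem relabel_unique {g : unitInterval ≃ₜ unitInterval} {s s' t t' : BTree}
    (h : IsTreePair g s t) (h' : IsTreePair g s' t') (x : cableHom t.leaves)
    (x' : cableHom t'.leaves) (e : toLimit t x = toLimit t' x') :
    toLimit s (relabel h.leaves_eq x) = toLimit s' (relabel h'.leaves_eq x') := by
  obtain ⟨u, ht, ht', e⟩ := toLimit_eq e
  rw [toLimit_relabel h ht, toLimit_relabel h' ht', e]
  have h1 := h.refine ht
  have h2 := h'.refine ht'
  have key : ∀ {v w : BTree} (hv : IsTreePair g v u) (hw : IsTreePair g w u)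
      (y : cableHom u.leaves), toLimit v (relabel hv.leaves_eq y) =
        toLimit w (relabel hw.leaves_eq y) := by
    intro v w hv hw y
    obtain rfl := hv.unique hw
    rfl
  exact key h1 h2 _

theorem actFun_toLimit {g : thompsonF} {s t : BTree} (h : IsTreePair g s t)
    (x : cableHom t.leaves) :
    actFun g (toLimit t x) = toLimit s (relabel h.leaves_eq x) :=
  relabel_unique (exists_good g.2 (toLimit t x)).choose_spec.choose_spec.choose_spec.1 h _ x
    (exists_good g.2 (toLimit t x)).choose_spec.choose_spec.choose_spec.2

theorem exists_good₂ (g : thompsonF) (z w : Limit) :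
    ∃ s t x y, IsTreePair g s t ∧ toLimit t x = z ∧ toLimit t y = w := by
  obtain ⟨s, t, h⟩ := g.2
  obtain ⟨u, x, y, rfl, rfl⟩ := exists_toLimit₂ z w
  obtain ⟨v, ht, hu⟩ := exists_ge_ge t u
  exact ⟨_, v, transition u v hu x, transition u v hu y, h.refine ht, toLimit_transition hu x,
    toLimit_transition hu y⟩

theorem actFun_one (z : Limit) : actFun 1 z = z := by
  obtain ⟨t, x, rfl⟩ := exists_toLimit z
  exact actFun_toLimit (g := 1) (isTreePair_one t) x

theorem actFun_mul (g h : thompsonF) (z : Limit) : actFun (g * h) z = actFun g (actFun h z) := by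
  obtain ⟨s, t, hg⟩ := g.2
  obtain ⟨u, v, x, hh, rfl⟩ := exists_good h.2 z
  obtain ⟨b, ht, hu⟩ := exists_ge_ge t u
  have hb := hg.refine ht
  have hc : IsTreePair h b (v.attach (u.forest b)) := by simpa using (hh.inv.refine hu).inv
  rw [← toLimit_transition (le_attach v (u.forest b)) x, actFun_toLimit hc, actFun_toLimit hb,
    actFun_toLimit (g := g * h) (hb.mul hc)]
  rfl

/-- The action of `g` on the direct limit is a linear bijection. -/
noncomputable def act (g : thompsonF) : Limit ≃ₗ[ℂ] Limit where
  toFun := actFun g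
  invFun := actFun g⁻¹
  left_inv z := by rw [← actFun_mul, inv_mul_cancel, actFun_one]
  right_inv z := by rw [← actFun_mul, mul_inv_cancel, actFun_one]
  map_add' z w := by
    obtain ⟨s, t, x, y, h, rfl, rfl⟩ := exists_good₂ g z w
    rw [← map_add, actFun_toLimit h, actFun_toLimit h, actFun_toLimit h, map_add, map_add]
  map_smul' c z := by
    obtain ⟨s, t, x, h, rfl⟩ := exists_good g.2 z
    rw [← map_smul, actFun_toLimit h, actFun_toLimit h, map_smul, map_smul]
    rfl

theorem norm_act (g : thompsonF) (z : Limit) : ‖act g z‖ = ‖z‖ := by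
  obtain ⟨s, t, x, h, rfl⟩ := exists_good g.2 z
  change ‖actFun g (toLimit t x)‖ = _
  rw [actFun_toLimit h, norm_eq_sqrt_re_inner (𝕜 := ℂ), norm_eq_sqrt_re_inner (𝕜 := ℂ),
    inner_toLimit, inner_toLimit]
  rfl

noncomputable abbrev toHilbert : Limit →ₗ[ℂ] HilbertSpace :=
  (UniformSpace.Completion.toComplₗᵢ (𝕜 := ℂ) (E := Limit)).toLinearMap

theorem denseRange_toHilbert : DenseRange toHilbert := UniformSpace.Completion.denseRange_coe

/-- The unitary operator `π(g)`, the extension of the action of `g` to the completion. -/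
noncomputable def unitary (g : thompsonF) : HilbertSpace ≃ₗᵢ[ℂ] HilbertSpace :=
  (act g).extendOfIsometry toHilbert toHilbert denseRange_toHilbert denseRange_toHilbert
    (fun z => by
      change ‖((act g z : Limit) : HilbertSpace)‖ = ‖((z : Limit) : HilbertSpace)‖
      rw [UniformSpace.Completion.norm_coe, UniformSpace.Completion.norm_coe, norm_act])

theorem unitary_coe (g : thompsonF) (z : Limit) :
    unitary g (z : HilbertSpace) = ((act g z : Limit) : HilbertSpace) :=
  LinearEquiv.extendOfIsometry_eq (f := act g) (e₁ := toHilbert) (e₂ := toHilbert) _ _ _ z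

/-- The unitary representation `π` of Thompson's group `F` on the Hilbert space. -/
noncomputable def jonesRep : thompsonF →* (HilbertSpace ≃ₗᵢ[ℂ] HilbertSpace) where
  toFun := unitary
  map_one' := by
    ext z
    induction z using UniformSpace.Completion.induction_on with
    | hp => exact isClosed_eq (unitary 1).continuous continuous_id
    | ih z =>
      rw [unitary_coe]
      exact congrArg _ (actFun_one z)
  map_mul' g h := by
    ext z
    induction z using UniformSpace.Completion.induction_on with
    | hp =>
      have hc := (unitary g).continuous.comp (unitary h).continuous
      exact isClosed_eq (unitary (g * h)).continuous hc
    | ih z =>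
      change unitary (g * h) z = unitary g (unitary h z)
      rw [unitary_coe, unitary_coe, unitary_coe]
      exact congrArg _ (actFun_mul g h z)

/-- The 3-colorable subgroup: the stabilizer of the vacuum vector. -/
noncomputable def threeColorable : Subgroup thompsonF where
  carrier := {g | jonesRep g vacuum = vacuum}
  one_mem' := by
    change jonesRep 1 vacuum = vacuum
    rw [map_one]
    rfl
  mul_mem' {g h} hg hh := by
    change jonesRep g vacuum = vacuum at hg
    change jonesRep h vacuum = vacuum at hh
    change jonesRep (g * h) vacuum = vacuum
    rw [map_mul]
    change jonesRep g (jonesRep h vacuum) = vacuum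
    rw [hh, hg]
  inv_mem' {g} hg := by
    change jonesRep g vacuum = vacuum at hg
    change jonesRep g⁻¹ vacuum = vacuum
    conv_lhs => rw [← hg]
    change (jonesRep g⁻¹ * jonesRep g) vacuum = vacuum
    rw [← map_mul, inv_mul_cancel, map_one]
    rfl

/-! ### The dual graph, the trees generated by one tree, and the groups `F_N` -/

/-- `t.IsEdge k i j`: when the leaves of `t` lie between the regions `k, k + 1, k + 2, …`, some
edge of `t` separates the regions `i` and `j`.  The edges of a tree are the root edge, which comes from
above and separates the regions on the left and on the right of the whole tree, and the edges
of the two trees below the root vertex. -/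
inductive BTree.IsEdge : BTree → ℕ → ℕ → ℕ → Prop
  | root (t : BTree) (k : ℕ) : BTree.IsEdge t k k (k + t.leaves)
  | left {l r : BTree} {k i j : ℕ} : BTree.IsEdge l k i j → BTree.IsEdge (.node l r) k i j
  | right {l r : BTree} {k i j : ℕ} :
      BTree.IsEdge r (k + l.leaves) i j → BTree.IsEdge (.node l r) k i j

/-- The dual graph `Γ(T₊, T₋)` of the cubic planar graph made of `T₊` in the upper half plane and
the reflected `T₋` in the lower half plane, with the leaves glued.  The vertices are the regions
`0, 1, …, n`, from left to right, where `n` is the number of leaves; two regions are adjacent when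
an edge of one of the trees separates them. -/
def dualGraph (Tp Tm : BTree) : SimpleGraph (Fin (Tp.leaves + 1)) :=
  SimpleGraph.fromRel fun i j => Tp.IsEdge 0 i j ∨ Tm.IsEdge 0 i j

/-- The tree with four leaves, all of depth two. -/
def treeX : BTree := .node (.node .leaf .leaf) (.node .leaf .leaf)

/-- The trees in `Alg(X)`: those made from the trivial tree by repeatedly putting a copy of `X` on
a leaf, the `k`-th one from the left, starting from `0`. -/
inductive Alg (X : BTree) : BTree → Prop
  | leaf : Alg X .leaf
  | mul_shift {T : BTree} (k : ℕ) : k < T.leaves → Alg X T →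
      Alg X (T.attach ((List.replicate T.leaves BTree.leaf).set k X))

/-- The Thompson group `F_N`, for `N ≥ 2`, presented by generators `x₀, x₁, x₂, …` and the relations
`x_k⁻¹ x_n x_k = x_{n + N - 1}` for `k < n`. -/
abbrev ThompsonGroup (N : ℕ) : Type :=
  PresentedGroup {w : FreeGroup ℕ | ∃ k n, k < n ∧ w = (FreeGroup.of k)⁻¹ * FreeGroup.of n *
    FreeGroup.of k * (FreeGroup.of (n + (N - 1)))⁻¹}

end ThreeColor

/-!
The 3-colorable subgroup consists of the elements that preserve the parity of the depth of leaves,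
and it is generated by the pairs of four-ary trees.

Diagrams act on colourings of the regions between strings, and this action computes the inner product
(`TL.inner_eq`).  The idempotent on a cable kills the colourings in which the two sides of the cable
have the same colour, and with three colours the trivalent vertex therefore sends a colouring to a
single one, in which the new region has the third colour (`rep_trivalent_ket`).  Hence a tree sends
the colouring `0, 1` to the only compatible colouring of the regions between its leaves
(`rep_tree_ket`).  If `(s, t)` represents `g`, the vectors `π(g)ξ` and `ξ` are the trees `t` and `s`,
read on the partition of `s`; so `g` fixes `ξ` if and only if the two trees give the same colouring.
This is the existence of a proper colouring of the dual graph, as the two sides of the root edge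
always have different colours (`dualGraph_colorable_iff`).

Write the colours as residues modulo 3.  The two edges below an edge across which the colour grows by
`1` are edges across which it grows by `2`, and conversely.  So the colouring of a tree amounts to
the list of parities of the depths of its leaves (`BTree.parities`), and `g` fixes `ξ` if and only if
these lists agree (`mem_threeColorable_iff`).  In this case, halving the intervals of odd depth turns
both trees into trees with leaves of even depth only, and these are the trees in `Alg(X)`, which can
be read as four-ary trees (`QTree`, `alg_treeX_iff`, `mem_threeColorable_iff_exists`).

For the presentation, `x_k` is sent to the element represented by a vine (the tree that grows on its
last leaf) with one more caret on the leaf `k`, and a longer vine.  The defining relation says that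
carets on two leaves can be added in either order (`QTree.addCaret_comm`).  Conversely, a four-ary
tree `T` defines an element `T.lastWord 0` of the presented group, which is multiplied by `x_k` when
a caret is added on a leaf `k` other than the last one (`lastWord_addCaret`), and which is sent to the
element represented by `T` and a vine (`isQTreePair_lastWord`).  This gives surjectivity.  Every
element of the presented group is a fraction of positive words, so that it comes from a pair of trees
with the same number of leaves (`exists_lastWord_mul_inv`); if its image is trivial, the two trees
are equal, and so is the element.
-/

namespace ThreeColor

open BTree TL

/-! ### Parities of the depths of leaves -/

/-- The list, from left to right, of the parities of the depths of the leaves: `b` for a leaf of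
even depth and `!b` for a leaf of odd depth. -/
def BTree.parities : BTree → Bool → List Bool
  | leaf, b => [b]
  | node l r, b => l.parities (!b) ++ r.parities (!b)

theorem length_parities (t : BTree) (b : Bool) : (t.parities b).length = t.leaves := by
  induction t generalizing b with
  | leaf => rfl
  | node l r hl hr => simp [parities, leaves, hl, hr]

theorem parities_not (t : BTree) (b : Bool) : t.parities (!b) = (t.parities b).map (! ·) := by
  induction t generalizing b with
  | leaf => rfl
  | node l r hl hr => rw [parities, hl (!b), hr (!b), parities, List.map_append]

theorem parities_eq_iff {s t : BTree} (b : Bool) :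
    s.parities b = t.parities b ↔ s.parities true = t.parities true := by
  cases b with
  | true => rfl
  | false =>
    rw [show false = !true from rfl, parities_not, parities_not]
    exact (List.map_injective_iff.2 Bool.not_injective).eq_iff

/-- The change of colour from left to right across an edge of a tree, that is a cable, of parity `b`. -/
def step (b : Bool) : Fin 3 := if b then 1 else 2

theorem ne_add_step (a : Fin 3) (b : Bool) : a ≠ a + step b := by decide +revert

theorem eq_add_step_not_iff (a c : Fin 3) (b : Bool) :
    c = a + step (!b) ↔ c ≠ a ∧ c ≠ a + step b := by decide +revert

theorem step_injective : Function.Injective step := by decide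

theorem step_not_add_step_not (b : Bool) : step (!b) + step (!b) = step b := by cases b <;> decide

/-- The colouring that starts with `a`, changes according to the parities in the list, and goes on
with `f c` when the colour `c` is reached after the last change. -/
def walk (f : Fin 3 → Spins) : Fin 3 → List Bool → Spins
  | a, [] => f a
  | a, b :: L => ins 0 a (walk f (a + step b) L)

theorem ins_zero_zero (a : Fin 3) (σ : Spins) : ins 0 a σ 0 = a := by simp [ins]

theorem ins_zero_succ (a : Fin 3) (σ : Spins) (j : ℕ) : ins 0 a σ (j + 1) = σ j := by simp [ins]

theorem ins_zero_injective (a : Fin 3) : Function.Injective (ins 0 a) :=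
  Function.LeftInverse.injective (del_ins 0 a)

theorem walk_append (f : Fin 3 → Spins) (a : Fin 3) (L L' : List Bool) :
    walk f a (L ++ L') = walk (fun c => walk f c L') a L := by
  induction L generalizing a with
  | nil => rfl
  | cons b L ih => simp [walk, ih]

theorem walk_zero {f : Fin 3 → Spins} (hf : ∀ c, f c 0 = c) (a : Fin 3) (L : List Bool) :
    walk f a L 0 = a := by
  cases L with
  | nil => exact hf a
  | cons b L => exact ins_zero_zero _ _

theorem walk_injective {f : Fin 3 → Spins} (hf : ∀ c, f c 0 = c) {L L' : List Bool}
    (hl : L.length = L'.length) {a : Fin 3} (h : walk f a L = walk f a L') : L = L' := by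
  induction L generalizing a L' with
  | nil => exact (List.length_eq_zero_iff.1 hl.symm).symm
  | cons b L ih =>
    cases L' with
    | nil => simp at hl
    | cons b' L' =>
      have h' := ins_zero_injective a h
      have h0 := congrFun h' 0
      rw [walk_zero hf, walk_zero hf] at h0
      obtain rfl := step_injective (add_left_cancel h0)
      rw [ih (by simpa using hl) h']

/-! ### Trees acting on colourings -/

theorem rep_shift_mapDomain {x : TL} (a : Fin 3) (φ : Spins →₀ ℂ) :
    rep (shift x) (Finsupp.lmapDomain ℂ ℂ (ins 0 a) φ) =
      Finsupp.lmapDomain ℂ ℂ (ins 0 a) (rep x φ) := by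
  have hk : ∀ σ, Finsupp.lmapDomain ℂ ℂ (ins 0 a) (ket σ) = ket (ins 0 a σ) := by simp
  induction x using TL.induction generalizing φ with
  | scalar c => simp only [AlgHom.commutes, Module.algebraMap_end_apply, map_smul]
  | cup_mul i x ih =>
    rw [map_mul, map_mul, map_mul, Module.End.mul_apply, Module.End.mul_apply, ih, shift_cup,
      rep_cup, rep_cup]
    generalize rep x φ = ψ
    induction ψ using spin_induction with
    | ket' σ =>
      rw [hk, cupOp_ket, cupOp_ket, map_sum]
      refine Finset.sum_congr rfl fun c _ => ?_
      rw [map_smul, hk, Nat.add_div_right _ two_pos, ins_ins (Nat.zero_le _)]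
      simp [cupWt, ins_zero_succ]
    | smul c ψ ih => simp only [map_smul, ih]
    | add ψ ψ' h h' => simp only [map_add, h, h']
  | cap_mul i x ih =>
    rw [map_mul, map_mul, map_mul, Module.End.mul_apply, Module.End.mul_apply, ih, shift_cap,
      rep_cap, rep_cap]
    generalize rep x φ = ψ
    induction ψ using spin_induction with
    | ket' σ =>
      rw [hk, capOp_ket, capOp_ket, map_smul, hk, Nat.add_div_right _ two_pos,
        del_ins_of_le' (Nat.zero_le _)]
      simp [capWt, ins_zero_succ]
    | smul c ψ ih => simp only [map_smul, ih]
    | add ψ ψ' h h' => simp only [map_add, h, h']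
  | smul c x ih => simp only [map_smul, LinearMap.smul_apply, ih]
  | add x y hx hy => simp only [map_add, LinearMap.add_apply, hx, hy]

theorem rep_shift_ket {x : TL} {σ τ : Spins} (h : rep x (ket σ) = ket τ) (a : Fin 3) :
    rep (shift x) (ket (ins 0 a σ)) = ket (ins 0 a τ) := by
  have := rep_shift_mapDomain (x := x) a (ket σ)
  rw [h] at this
  simpa using this

theorem rep_shiftBy_walk {x : TL} {f g : Fin 3 → Spins} (h : ∀ c, rep x (ket (f c)) = ket (g c))
    (a : Fin 3) (L : List Bool) :
    rep (shiftBy L.length x) (ket (walk f a L)) = ket (walk g a L) := by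
  induction L generalizing a with
  | nil => exact h a
  | cons b L ih => exact rep_shift_ket (ih _) a

/-- The Jones–Wenzl idempotent fixes the colourings in which its two outer regions have different
colours. -/
theorem rep_jw_ket_of_ne {m : ℕ} {σ : Spins} (h : σ m ≠ σ (m + 1)) :
    rep (jw (2 * m)) (ket σ) = ket σ := by
  rw [jw, map_sub, map_one, map_smul, map_mul, rep_cup, rep_cap, LinearMap.sub_apply,
    LinearMap.smul_apply, Module.End.mul_apply, capOp_ket]
  simp [capWt, h]

theorem rep_jw_ket_of_eq {m : ℕ} {σ : Spins} (h : σ m = σ (m + 1)) :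
    rep (jw (2 * m)) (ket σ) = 0 := by
  have hd : del (m + 1) σ m = σ m := by simp [del]
  rw [jw, map_sub, map_one, map_smul, map_mul, rep_cup, rep_cap, LinearMap.sub_apply,
    LinearMap.smul_apply, Module.End.mul_apply, cupOp_capOp_ket]
  have e : ∀ c, (capWt (2 * m) σ * cupWt (2 * m) c (del (2 * m / 2 + 1) σ)) •
      ket (ins (2 * m / 2 + 1) c (del (2 * m / 2 + 1) σ)) =
        if c = σ (m + 1) then loopValue • ket σ else 0 := by
    intro c
    rw [Nat.mul_div_cancel_left _ two_pos]
    split_ifs with hc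
    · rw [hc, ins_del]
      simp [capWt, cupWt, h, hd, fourthRoot_mul_self]
    · simp [cupWt, hd, h, Ne.symm hc]
  rw [Finset.sum_congr rfl fun c _ => e c]
  simp [loopValue_ne_zero]

/-- The trivalent vertex puts the third colour between the colours on the two sides of its input
cable. -/
theorem rep_trivalent_ket (a : Fin 3) (b : Bool) {τ : Spins} (h : τ 0 = a + step b) :
    rep trivalent (ket (ins 0 a τ)) = ket (ins 0 a (ins 0 (a + step (!b)) τ)) := by
  have e0 : rep (jw 0) (ket (ins 0 a τ)) = ket (ins 0 a τ) := by
    refine rep_jw_ket_of_ne (m := 0) ?_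
    rw [ins_zero_zero, ins_zero_succ, h]
    exact ne_add_step a b
  have e1 : ∀ c, rep (jw 0) (rep (jw 2) (ket (ins 0 a (ins 0 c τ)))) =
      if c = a + step (!b) then ket (ins 0 a (ins 0 c τ)) else 0 := by
    intro c
    have h0 : ins 0 a (ins 0 c τ) 0 = a := rfl
    have h1 : ins 0 a (ins 0 c τ) 1 = c := rfl
    have h2 : ins 0 a (ins 0 c τ) 2 = a + step b := h
    simp only [eq_add_step_not_iff]
    by_cases hc : c = a + step b
    · rw [rep_jw_ket_of_eq (m := 1) (by rw [h1, h2, hc]), map_zero, if_neg fun h => h.2 hc]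
    · rw [rep_jw_ket_of_ne (m := 1) (by rw [h1, h2]; exact hc)]
      by_cases hc' : c = a
      · rw [rep_jw_ket_of_eq (m := 0) (by rw [h0, h1, hc']), if_neg fun h => h.1 hc']
      · rw [rep_jw_ket_of_ne (m := 0) (by rw [h0, h1]; exact Ne.symm hc'), if_pos ⟨hc', hc⟩]
  rw [trivalent, map_smul, map_mul, map_mul, map_mul, LinearMap.smul_apply, Module.End.mul_apply,
    Module.End.mul_apply, Module.End.mul_apply, e0, rep_cup, cupOp_ket]
  have e2 : ∀ c, ins (1 / 2 + 1) c (ins 0 a τ) = ins 0 a (ins 0 c τ) :=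
    fun c => ins_ins (Nat.zero_le 0) a c τ
  simp only [map_sum, map_smul, e2, e1]
  simp [cupWt, fourthRoot_ne_zero]

/-- A tree with trivalent vertices sends a colouring to the only compatible colouring of the
regions between its leaves. -/
theorem rep_tree_walk (t : BTree) {f : Fin 3 → Spins} (hf : ∀ c, f c 0 = c) (a : Fin 3) (b : Bool) :
    rep (tree t) (ket (walk f a [b])) = ket (walk f a (t.parities b)) := by
  induction t generalizing f a b with
  | leaf =>
    refine rep_jw_ket_of_ne (m := 0) ?_
    rw [walk, ins_zero_zero, ins_zero_succ, walk, hf]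
    exact ne_add_step a b
  | node l r hl hr =>
    have e : rep trivalent (ket (walk f a [b])) =
        ket (walk (fun c => walk f c [!b]) a [!b]) := by
      rw [walk, walk, rep_trivalent_ket a b (hf _)]
      simp only [walk, add_assoc, step_not_add_step_not]
    rw [tree, map_mul, map_mul, Module.End.mul_apply, Module.End.mul_apply, e,
      hl (f := fun c => walk f c [!b]) fun c => walk_zero hf _ _, ← length_parities l (!b),
      rep_shiftBy_walk fun c => hr hf c (!b), parities, walk_append]

theorem rep_tree_ket (t : BTree) : rep (tree t) (ket fun j => if j = 0 then 0 else 1) =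
    ket (walk (fun c => ins 0 c fun _ => 1) 0 (t.parities true)) := by
  rw [← rep_tree_walk t (fun c => ins_zero_zero c _)]
  congr 2
  funext j
  rcases j with _ | _ | j <;> simp [walk, ins, step]

/-! ### The stabilizer of the vacuum vector -/

/-- A tree, as a vector with one input cable and one output cable for each leaf. -/
noncomputable def treeVec (t : BTree) : cableHom t.leaves :=
  ⟨tree t, tree_mem t, proj_mul_tree t, tree_mul_jw t⟩

theorem toLimit_treeVec (t : BTree) : toLimit t (treeVec t) = vacuumLimit := by
  rw [vacuumLimit, ← toLimit_transition (leaf_le t)]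
  congr 1
  exact Subtype.ext (forestMap_mul_tree (leaf_le t)).symm

theorem norm_toLimit_eq_zero_iff {t : BTree} (x : cableHom t.leaves) :
    ‖toLimit t x‖ = 0 ↔ rep x (ket fun j => if j = 0 then 0 else 1) = 0 := by
  rw [norm_eq_sqrt_re_inner (𝕜 := ℂ), inner_toLimit, inner_eq x.2 x.2, spinInner_self,
    RCLike.re_to_complex, Complex.ofReal_re]
  generalize rep x _ = φ
  have h0 : ∀ σ ∈ φ.support, 0 ≤ ‖φ σ‖ ^ 2 := fun _ _ => sq_nonneg _
  rw [Finsupp.sum, Real.sqrt_eq_zero (Finset.sum_nonneg h0), Finset.sum_eq_zero_iff_of_nonneg h0]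
  constructor
  · intro h
    ext σ
    by_contra hσ
    exact hσ (by simpa using h σ (Finsupp.mem_support_iff.2 hσ))
  · rintro rfl
    simp

theorem mem_threeColorable_iff {g : thompsonF} {s t : BTree} (h : IsTreePair g s t) :
    g ∈ threeColorable ↔ s.parities true = t.parities true := by
  have h1 : jonesRep g vacuum = ((toLimit s (relabel h.leaves_eq (treeVec t)) : Limit) :
      HilbertSpace) := by
    change unitary g _ = _
    rw [vacuum, unitary_coe, ← toLimit_treeVec t]
    exact congrArg _ (actFun_toLimit h _)
  change jonesRep g vacuum = vacuum ↔ _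
  rw [h1, vacuum, ← toLimit_treeVec s, ← sub_eq_zero, ← UniformSpace.Completion.coe_sub,
    ← norm_eq_zero, UniformSpace.Completion.norm_coe, ← map_sub, norm_toLimit_eq_zero_iff]
  change rep (tree t - tree s) _ = 0 ↔ _
  rw [map_sub, LinearMap.sub_apply, sub_eq_zero, rep_tree_ket, rep_tree_ket]
  constructor
  · intro e
    refine (walk_injective (fun c => ins_zero_zero c _) ?_
      (Finsupp.single_left_injective one_ne_zero e)).symm
    rw [length_parities, length_parities, h.leaves_eq]
  · intro e
    rw [e]

/-! ### Colourings of the dual graph -/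

/-- The colours of the regions `k, k + 1, …` change according to the parities in the list. -/
def Follows (σ : Spins) : ℕ → List Bool → Prop
  | _, [] => True
  | k, b :: L => σ (k + 1) = σ k + step b ∧ Follows σ (k + 1) L

theorem follows_append {σ : Spins} {k : ℕ} {L L' : List Bool} :
    Follows σ k (L ++ L') ↔ Follows σ k L ∧ Follows σ (k + L.length) L' := by
  induction L generalizing k with
  | nil => simp [Follows]
  | cons b L ih => simp [Follows, ih, and_assoc, add_assoc, add_comm 1]

theorem Follows.unique {σ : Spins} {k : ℕ} {L L' : List Bool} (h : Follows σ k L)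
    (h' : Follows σ k L') (hl : L.length = L'.length) : L = L' := by
  induction L generalizing k L' with
  | nil => exact (List.length_eq_zero_iff.1 hl.symm).symm
  | cons b L ih =>
    cases L' with
    | nil => simp at hl
    | cons b' L' =>
      obtain rfl := step_injective (add_left_cancel (h.1.symm.trans h'.1))
      rw [ih h.2 h'.2 (by simpa using hl)]

theorem follows_ins_zero {σ : Spins} {a : Fin 3} {k : ℕ} {L : List Bool} :
    Follows (ins 0 a σ) (k + 1) L ↔ Follows σ k L := by
  induction L generalizing k with
  | nil => simp [Follows]
  | cons b L ih => simp [Follows, ih, ins_zero_succ]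

theorem follows_walk {f : Fin 3 → Spins} (hf : ∀ c, f c 0 = c) (a : Fin 3) (L : List Bool) :
    Follows (walk f a L) 0 L := by
  induction L generalizing a with
  | nil => trivial
  | cons b L ih =>
    refine ⟨?_, follows_ins_zero.2 (ih _)⟩
    rw [walk, ins_zero_zero, ins_zero_succ, walk_zero hf]

theorem Follows.end_eq {σ : Spins} {t : BTree} {k : ℕ} {b : Bool}
    (h : Follows σ k (t.parities b)) : σ (k + t.leaves) = σ k + step b := by
  induction t generalizing k b with
  | leaf => exact h.1
  | node l r hl hr =>
    obtain ⟨h1, h2⟩ := follows_append.1 h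
    rw [length_parities] at h2
    rw [leaves, ← add_assoc, hr h2, hl h1, add_assoc, step_not_add_step_not]

theorem Follows.ne_of_isEdge {σ : Spins} {t : BTree} {k i j : ℕ} (he : t.IsEdge k i j) {b : Bool}
    (h : Follows σ k (t.parities b)) : σ i ≠ σ j := by
  induction he generalizing b with
  | root t k =>
    rw [h.end_eq]
    exact ne_add_step _ b
  | left _ ih => exact ih (follows_append.1 h).1
  | right _ ih =>
    have h2 := (follows_append.1 h).2
    rw [length_parities] at h2
    exact ih h2

/-- A proper colouring of the edges of a tree is determined by the colours on the two sides of the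
root edge. -/
theorem follows_of_isEdge {σ : Spins} {t : BTree} {k : ℕ} {b : Bool}
    (h : ∀ i j, t.IsEdge k i j → σ i ≠ σ j) (hb : σ (k + t.leaves) = σ k + step b) :
    Follows σ k (t.parities b) := by
  induction t generalizing k b with
  | leaf => exact ⟨hb, trivial⟩
  | node l r hl hr =>
    have h1 := h _ _ (.left (.root l k))
    have h2 := h _ _ (.right (.root r _))
    rw [leaves, ← add_assoc] at hb
    rw [hb] at h2
    have key : ∀ (x y : Fin 3) (b : Bool), x ≠ y → y ≠ x + step b →
        y = x + step (!b) ∧ x + step b = y + step (!b) := by decide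
    obtain ⟨e1, e2⟩ := key _ _ _ h1 h2
    refine follows_append.2 ⟨hl (fun i j he => h i j (.left he)) e1, ?_⟩
    rw [length_parities]
    exact hr (fun i j he => h i j (.right he)) (hb.trans e2)

theorem BTree.IsEdge.le_lt_le {t : BTree} {k i j : ℕ} (h : t.IsEdge k i j) :
    k ≤ i ∧ i < j ∧ j ≤ k + t.leaves := by
  induction h with
  | root t k => exact ⟨le_rfl, Nat.lt_add_of_pos_right (leaves_pos t), le_rfl⟩
  | left _ ih => simp only [leaves]; omega
  | right _ ih => simp only [leaves]; omega

theorem dualGraph_colorable_iff {s t : BTree} (h : s.leaves = t.leaves) :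
    (dualGraph s t).Colorable 3 ↔ s.parities true = t.parities true := by
  constructor
  · rintro ⟨C⟩
    let σ : Spins := fun j => if hj : j < s.leaves + 1 then C ⟨j, hj⟩ else 0
    have hσ : ∀ i j, s.IsEdge 0 i j ∨ t.IsEdge 0 i j → σ i ≠ σ j := by
      intro i j he
      have hij : i < j ∧ j ≤ s.leaves := by
        rcases he with he | he <;> have := he.le_lt_le <;> omega
      simp only [σ, dif_pos (show i < s.leaves + 1 by omega),
        dif_pos (show j < s.leaves + 1 by omega)]
      refine C.valid ((SimpleGraph.fromRel_adj _ _ _).2 ⟨?_, .inl he⟩)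
      simp only [ne_eq, Fin.mk.injEq]
      omega
    have h0 : σ 0 ≠ σ (0 + s.leaves) := hσ _ _ (.inl (.root s 0))
    have key : ∀ x y : Fin 3, x ≠ y → ∃ b, y = x + step b := by decide
    obtain ⟨b, hb⟩ := key _ _ h0
    rw [← parities_eq_iff b]
    refine (follows_of_isEdge (fun i j he => hσ i j (.inl he)) hb).unique
      (follows_of_isEdge (fun i j he => hσ i j (.inr he)) (h ▸ hb)) ?_
    rw [length_parities, length_parities, h]
  · intro e
    have hf := follows_walk (fun c => ins_zero_zero c fun _ => 0) 0 (s.parities true)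
    have hf' := hf
    nth_rewrite 2 [e] at hf'
    refine ⟨SimpleGraph.Coloring.mk
      (fun i => walk (fun c => ins 0 c fun _ => 0) 0 (s.parities true) i) ?_⟩
    intro i j hij
    rcases ((SimpleGraph.fromRel_adj _ _ _).1 hij).2 with (he | he) | (he | he)
    · exact hf.ne_of_isEdge he
    · exact hf'.ne_of_isEdge he
    · exact (hf.ne_of_isEdge he).symm
    · exact (hf'.ne_of_isEdge he).symm

/-! ### Elements of Thompson's group from pairs of trees -/

theorem exists_mem_intervals (t : BTree) {a b x : ℝ} (ha : a ≤ x) (hb : x ≤ b) :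
    ∃ I ∈ t.intervals a b, I.1 ≤ x ∧ x ≤ I.2 := by
  induction t generalizing a b with
  | leaf => exact ⟨(a, b), by simp [intervals], ha, hb⟩
  | node l r hl hr =>
    simp only [intervals, List.mem_append]
    rcases le_total x ((a + b) / 2) with h | h
    · obtain ⟨I, hI, hx⟩ := hl ha h
      exact ⟨I, .inl hI, hx⟩
    · obtain ⟨I, hI, hx⟩ := hr h hb
      exact ⟨I, .inr hI, hx⟩

theorem IsTreePair.eq_one {g : unitInterval ≃ₜ unitInterval} {t : BTree} (h : IsTreePair g t t) :
    g = 1 := by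
  ext x
  obtain ⟨I, hI, h1, h2⟩ := exists_mem_intervals t x.2.1 x.2.2
  have hlt := (mem_intervals t 0 1 one_pos I hI).2.1
  have hd : 0 < I.2 - I.1 := sub_pos.2 hlt
  have hx : (x : ℝ) = I.1 + (x - I.1) / (I.2 - I.1) * (I.2 - I.1) := by
    rw [div_mul_cancel₀ _ hd.ne']; ring
  refine (List.forall₂_same.1 h I hI ((x - I.1) / (I.2 - I.1)) ⟨?_, ?_⟩ x hx).trans hx.symm
  · exact div_nonneg (sub_nonneg.2 h1) hd.le
  · rw [div_le_one hd]; linarith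

theorem IsTreePair.ext {g g' : unitInterval ≃ₜ unitInterval} {s t : BTree} (h : IsTreePair g s t)
    (h' : IsTreePair g' s t) : g = g' :=
  (inv_mul_eq_one.1 (h'.inv.mul h).eq_one).symm

/-- The increasing bijection of the line that agrees with `e` on the left and with `e'` on the right
of a point at which they agree. -/
noncomputable def glue (e e' : ℝ ≃o ℝ) (m : ℝ) (h : e m = e' m) : ℝ ≃o ℝ where
  toFun x := if x ≤ m then e x else e' x
  invFun y := if y ≤ e m then e.symm y else e'.symm y
  left_inv x := by
    by_cases hx : x ≤ m
    · simp [hx]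
    · simp [hx, h]
  right_inv y := by
    by_cases hy : y ≤ e m
    · simp [hy, e.symm_apply_le]
    · have : ¬ e'.symm y ≤ m := by rwa [e'.symm_apply_le, ← h]
      simp [hy, this]
  map_rel_iff' {x y} := by
    have h1 := e.le_iff_le (x := x) (y := y)
    have h2 := e'.le_iff_le (x := x) (y := y)
    have h3 := e.le_iff_le (x := x) (y := m)
    have h4 := e'.le_iff_le (x := m) (y := y)
    have h5 := e'.le_iff_le (x := x) (y := m)
    have h6 := e.le_iff_le (x := m) (y := y)
    simp only [Equiv.coe_fn_mk]
    grind

theorem glue_of_le {e e' : ℝ ≃o ℝ} {m : ℝ} {h : e m = e' m} {x : ℝ} (hx : x ≤ m) :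
    glue e e' m h x = e x := if_pos hx

theorem glue_of_ge {e e' : ℝ ≃o ℝ} {m : ℝ} {h : e m = e' m} {x : ℝ} (hx : m ≤ x) :
    glue e e' m h x = e' x := by
  rcases hx.eq_or_lt with rfl | hx
  · rw [glue_of_le le_rfl, h]
  · exact if_neg hx.not_ge

/-- An increasing bijection of the line that maps the intervals of a standard dyadic partition
affinely onto successive intervals of length one. -/
theorem exists_orderIso (t : BTree) {a b : ℝ} (hab : a < b) (k : ℕ) :
    ∃ e : ℝ ≃o ℝ, e a = k ∧ e b = k + t.leaves ∧
      ∀ (i : ℕ) (I : ℝ × ℝ), (t.intervals a b)[i]? = some I → ∀ p ∈ Set.Icc (0 : ℝ) 1,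
        e (I.1 + p * (I.2 - I.1)) = k + i + p := by
  induction t generalizing a b k with
  | leaf =>
    have hd : 0 < b - a := sub_pos.2 hab
    refine ⟨((OrderIso.addRight (-a)).trans (OrderIso.mulRight₀ (b - a)⁻¹ (inv_pos.2 hd))).trans
      (OrderIso.addLeft (k : ℝ)), by simp, ?_, ?_⟩
    · simp [leaves, ← sub_eq_add_neg, hd.ne']
    · intro i I hI p _
      simp only [intervals, List.getElem?_singleton, Option.ite_none_right_eq_some,
        Option.some.injEq] at hI
      obtain ⟨rfl, rfl⟩ := hI
      simp [hd.ne']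
  | node l r hl hr =>
    obtain ⟨e, ha, hm, he⟩ := hl (show a < (a + b) / 2 by linarith) k
    obtain ⟨e', hm', hb, he'⟩ := hr (show (a + b) / 2 < b by linarith) (k + l.leaves)
    have h : e ((a + b) / 2) = e' ((a + b) / 2) := by rw [hm, hm']; push_cast; rfl
    refine ⟨glue e e' _ h, ?_, ?_, ?_⟩
    · rw [glue_of_le (by linarith), ha]
    · rw [glue_of_ge (by linarith), hb, leaves]
      push_cast
      ring
    · intro i I hI p hp
      rw [intervals] at hI
      rcases lt_or_ge i l.leaves with hi | hi
      · rw [List.getElem?_append_left (by rwa [length_intervals])] at hI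
        obtain ⟨-, h1, h2⟩ := mem_intervals l _ _ (by linarith) I (List.mem_of_getElem? hI)
        rw [glue_of_le (by nlinarith [hp.2]), he i I hI p hp]
      · rw [List.getElem?_append_right (by rwa [length_intervals]), length_intervals] at hI
        obtain ⟨h0, h1, -⟩ := mem_intervals r _ _ (by linarith) I (List.mem_of_getElem? hI)
        rw [glue_of_ge (by nlinarith [hp.1]), he' _ I hI p hp]
        push_cast [Nat.cast_sub hi]
        ring

/-- Any two trees with the same number of leaves represent an element of Thompson's group. -/
theorem exists_isTreePair {s t : BTree} (h : s.leaves = t.leaves) :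
    ∃ g : thompsonF, IsTreePair (g : unitInterval ≃ₜ unitInterval) s t := by
  obtain ⟨e, e0, e1, he⟩ := exists_orderIso s one_pos 0
  obtain ⟨e', e0', e1', he'⟩ := exists_orderIso t one_pos 0
  let E : ℝ ≃o ℝ := e'.trans e.symm
  have E0 : E 0 = 0 := by
    change e.symm (e' 0) = 0
    rw [e0', ← e0, e.symm_apply_apply]
  have E1 : E 1 = 1 := by
    change e.symm (e' 1) = 1
    rw [e1', ← h, ← e1, e.symm_apply_apply]
  have S0 : E.symm 0 = 0 := by rw [E.symm_apply_eq, E0]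
  have S1 : E.symm 1 = 1 := by rw [E.symm_apply_eq, E1]
  let G : unitInterval ≃o unitInterval :=
    { toFun := fun x => ⟨E x, by rw [← E0]; exact E.monotone x.2.1,
        (E.monotone x.2.2).trans_eq E1⟩
      invFun := fun x => ⟨E.symm x, by rw [← S0]; exact E.symm.monotone x.2.1,
        (E.symm.monotone x.2.2).trans_eq S1⟩
      left_inv := fun x => Subtype.ext (E.symm_apply_apply x)
      right_inv := fun x => Subtype.ext (E.apply_symm_apply x)
      map_rel_iff' := E.le_iff_le }
  have hG : IsTreePair G.toHomeomorph s t := by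
    refine List.forall₂_iff_get.2 ⟨by rw [length_intervals, length_intervals, h], ?_⟩
    intro i h1 h2 p hp x hx
    change e.symm (e' x) = _
    rw [e.symm_apply_eq, hx]
    exact (he' i _ (List.getElem?_eq_getElem h2) p hp).trans
      (he i _ (List.getElem?_eq_getElem h1) p hp).symm
  exact ⟨⟨G.toHomeomorph, s, t, hG⟩, hG⟩

/-! ### Four-ary trees -/

/-- Finite rooted planar trees every vertex of which has four children. -/
inductive QTree : Type
  | leaf : QTree
  | node : QTree → QTree → QTree → QTree → QTree

namespace QTree

/-- The number of leaves. -/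
def leaves : QTree → ℕ
  | leaf => 1
  | node a b c d => a.leaves + b.leaves + c.leaves + d.leaves

/-- The binary tree in which every four-ary vertex is replaced by a copy of `X`. -/
def toBTree : QTree → BTree
  | leaf => .leaf
  | node a b c d => .node (.node a.toBTree b.toBTree) (.node c.toBTree d.toBTree)

/-- Put a vertex with four leaves on the leaf number `k`, counted from `0`, from the left.  If there
is no such leaf, it is put on the last one. -/
def addCaret : QTree → ℕ → QTree
  | leaf, _ => node leaf leaf leaf leaf
  | node a b c d, k =>
    if k < a.leaves then node (a.addCaret k) b c d
    else if k < a.leaves + b.leaves then node a (b.addCaret (k - a.leaves)) c d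
    else if k < a.leaves + b.leaves + c.leaves then
      node a b (c.addCaret (k - (a.leaves + b.leaves))) d
    else node a b c (d.addCaret (k - (a.leaves + b.leaves + c.leaves)))

theorem leaves_pos (T : QTree) : 0 < T.leaves := by
  induction T with
  | leaf => exact Nat.one_pos
  | node a b c d ha hb hc hd => simp only [leaves]; omega

theorem leaves_addCaret (T : QTree) (k : ℕ) : (T.addCaret k).leaves = T.leaves + 3 := by
  induction T generalizing k with
  | leaf => rfl
  | node a b c d ha hb hc hd =>
    simp only [addCaret]
    split_ifs <;> simp only [leaves, ha, hb, hc, hd] <;> omega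

theorem addCaret_first {a b c d : QTree} {i : ℕ} (h : i < a.leaves) :
    (node a b c d).addCaret i = node (a.addCaret i) b c d := by
  simp [addCaret, h]

theorem addCaret_second {a b c d : QTree} {i : ℕ} (h : i < b.leaves) :
    (node a b c d).addCaret (a.leaves + i) = node a (b.addCaret i) c d := by
  simp [addCaret, h]

theorem addCaret_third {a b c d : QTree} {i : ℕ} (h : i < c.leaves) :
    (node a b c d).addCaret (a.leaves + b.leaves + i) = node a b (c.addCaret i) d := by
  rw [addCaret, if_neg (by omega), if_neg (by omega), if_pos (by omega), Nat.add_sub_cancel_left]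

theorem addCaret_fourth {a b c d : QTree} (i : ℕ) :
    (node a b c d).addCaret (a.leaves + b.leaves + c.leaves + i) = node a b c (d.addCaret i) := by
  rw [addCaret, if_neg (by omega), if_neg (by omega), if_neg (by omega), Nat.add_sub_cancel_left]

theorem exists_child {a b c d : QTree} {k : ℕ} (h : k < (node a b c d).leaves) :
    k < a.leaves ∨ (∃ i < b.leaves, k = a.leaves + i) ∨
      (∃ i < c.leaves, k = a.leaves + b.leaves + i) ∨
      ∃ i < d.leaves, k = a.leaves + b.leaves + c.leaves + i := by
  simp only [leaves] at h
  by_cases h1 : k < a.leaves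
  · exact .inl h1
  by_cases h2 : k < a.leaves + b.leaves
  · exact .inr (.inl ⟨k - a.leaves, by omega, by omega⟩)
  by_cases h3 : k < a.leaves + b.leaves + c.leaves
  · exact .inr (.inr (.inl ⟨k - (a.leaves + b.leaves), by omega, by omega⟩))
  · exact .inr (.inr (.inr ⟨k - (a.leaves + b.leaves + c.leaves), by omega, by omega⟩))

/-- Carets may be put on two leaves in either order; a caret on the left one moves the right one by
three places. -/
theorem addCaret_comm (T : QTree) {k n : ℕ} (hk : k < n) (hn : n < T.leaves) :
    (T.addCaret n).addCaret k = (T.addCaret k).addCaret (n + 3) := by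
  induction T generalizing k n with
  | leaf => simp only [leaves] at hn; omega
  | node a b c d ha hb hc hd =>
    simp only [leaves] at hn
    simp only [addCaret]
    split_ifs <;> simp only [addCaret, leaves_addCaret] <;> split_ifs <;>
    first
    | omega
    | rw [ha (by omega) (by omega)]
    | rw [hb (by omega) (by omega), Nat.sub_add_comm (by omega)]
    | rw [hc (by omega) (by omega), Nat.sub_add_comm (by omega)]
    | rw [hd (by omega) (by omega), Nat.sub_add_comm (by omega)]
    | (congr 2; omega)

theorem eq_leaf_or_eq_addCaret (T : QTree) :
    T = leaf ∨ ∃ (S : QTree) (k : ℕ), k < S.leaves ∧ T = S.addCaret k := by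
  induction T with
  | leaf => exact .inl rfl
  | node a b c d ha hb hc hd =>
    right
    rcases ha with rfl | ⟨S, k, hk, rfl⟩
    · rcases hb with rfl | ⟨S, k, hk, rfl⟩
      · rcases hc with rfl | ⟨S, k, hk, rfl⟩
        · rcases hd with rfl | ⟨S, k, hk, rfl⟩
          · exact ⟨leaf, 0, Nat.one_pos, rfl⟩
          · exact ⟨_, _, by simp only [leaves]; omega, (addCaret_fourth k).symm⟩
        · exact ⟨_, _, by simp only [leaves]; omega, (addCaret_third (d := d) hk).symm⟩
      · exact ⟨_, _, by simp only [leaves]; omega, (addCaret_second (c := c) (d := d) hk).symm⟩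
    · exact ⟨_, _, by simp only [leaves]; omega,
        (addCaret_first (b := b) (c := c) (d := d) hk).symm⟩

/-- Every four-ary tree arises from the trivial one by putting carets on leaves. -/
theorem addCaret_induction {C : QTree → Prop} (h1 : C leaf)
    (h2 : ∀ T k, k < T.leaves → C T → C (T.addCaret k)) (T : QTree) : C T := by
  induction hn : T.leaves using Nat.strong_induction_on generalizing T with
  | _ n ih =>
    rcases T.eq_leaf_or_eq_addCaret with rfl | ⟨S, k, hk, rfl⟩
    · exact h1
    · rw [leaves_addCaret] at hn
      exact h2 S k hk (ih S.leaves (by omega) S rfl)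

theorem leaves_toBTree (T : QTree) : T.toBTree.leaves = T.leaves := by
  induction T with
  | leaf => rfl
  | node a b c d ha hb hc hd => simp [toBTree, BTree.leaves, leaves, ha, hb, hc, hd, add_assoc]

theorem toBTree_injective : Function.Injective toBTree := by
  intro S
  induction S with
  | leaf =>
    intro T h
    cases T with
    | leaf => rfl
    | node => simp [toBTree] at h
  | node a b c d ha hb hc hd =>
    intro T h
    cases T with
    | leaf => simp [toBTree] at h
    | node =>
      simp only [toBTree, BTree.node.injEq] at h
      rw [ha h.1.1, hb h.1.2, hc h.2.1, hd h.2.2]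

theorem parities_toBTree (T : QTree) :
    T.toBTree.parities true = List.replicate T.leaves true := by
  induction T with
  | leaf => rfl
  | node a b c d ha hb hc hd =>
    simp [toBTree, parities, leaves, ha, hb, hc, hd]
    omega

end QTree

theorem BTree.attach_replicate (t : BTree) :
    t.attach (List.replicate t.leaves .leaf) = t := by
  induction t with
  | leaf => rfl
  | node l r hl hr => simp [attach, leaves, hl, hr]

theorem BTree.attach_set_left {l r : BTree} {k : ℕ} (h : k < l.leaves) (X : BTree) :
    (node l r).attach ((List.replicate (node l r).leaves leaf).set k X) =
      node (l.attach ((List.replicate l.leaves leaf).set k X)) r := by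
  simp [attach, leaves, List.take_set, List.drop_set, h, attach_replicate]

theorem BTree.attach_set_right {l r : BTree} (k : ℕ) (X : BTree) :
    (node l r).attach ((List.replicate (node l r).leaves leaf).set (l.leaves + k) X) =
      node l (r.attach ((List.replicate r.leaves leaf).set k X)) := by
  have h : (List.replicate l.leaves leaf).set (l.leaves + k) X = List.replicate l.leaves leaf :=
    List.set_eq_of_length_le (by simp)
  simp [attach, leaves, List.take_set, List.drop_set, attach_replicate, h]

theorem QTree.toBTree_addCaret (T : QTree) {k : ℕ} (hk : k < T.leaves) :
    (T.addCaret k).toBTree =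
      T.toBTree.attach ((List.replicate T.toBTree.leaves BTree.leaf).set k treeX) := by
  induction T generalizing k with
  | leaf =>
    obtain rfl : k = 0 := by simpa [leaves] using hk
    rfl
  | node a b c d ha hb hc hd =>
    rcases exists_child hk with h | ⟨i, h, rfl⟩ | ⟨i, h, rfl⟩ | ⟨i, h, rfl⟩
    · rw [addCaret_first h, toBTree, toBTree, ha h]
      rw [← leaves_toBTree] at h
      rw [attach_set_left (by simp only [BTree.leaves]; omega), attach_set_left h]
    · rw [addCaret_second h, toBTree, toBTree, hb h]
      rw [← leaves_toBTree] at h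
      rw [← leaves_toBTree, attach_set_left (by simp only [BTree.leaves]; omega), attach_set_right]
    · rw [addCaret_third h, toBTree, toBTree, hc h]
      rw [← leaves_toBTree] at h
      rw [← leaves_toBTree, ← leaves_toBTree,
        show a.toBTree.leaves + b.toBTree.leaves = (a.toBTree.node b.toBTree).leaves from rfl,
        attach_set_right, attach_set_left h]
    · rw [addCaret_fourth, toBTree, toBTree, hd h]
      rw [← leaves_toBTree, ← leaves_toBTree, ← leaves_toBTree,
        show a.toBTree.leaves + b.toBTree.leaves = (a.toBTree.node b.toBTree).leaves from rfl,
        add_assoc, attach_set_right, attach_set_right]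

/-- The trees in `Alg(X)` are the four-ary trees. -/
theorem alg_treeX_iff {t : BTree} : Alg treeX t ↔ ∃ T : QTree, T.toBTree = t := by
  constructor
  · intro h
    induction h with
    | leaf => exact ⟨.leaf, rfl⟩
    | mul_shift k hk _ ih =>
      obtain ⟨T, rfl⟩ := ih
      rw [QTree.leaves_toBTree] at hk
      exact ⟨T.addCaret k, T.toBTree_addCaret hk⟩
  · rintro ⟨T, rfl⟩
    induction T using QTree.addCaret_induction with
    | h1 => exact .leaf
    | h2 T k hk ih =>
      rw [T.toBTree_addCaret hk]
      exact .mul_shift k (by rwa [QTree.leaves_toBTree]) ih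

/-- The forest that has one binary caret for each leaf of odd depth and nothing for the other
leaves. -/
def oddCarets (L : List Bool) : List BTree := L.map fun b => if b then .leaf else .node .leaf .leaf

/-- Once the leaves of odd depth are halved, all the leaves have even depth, so that the tree is made
of copies of `X`. -/
theorem exists_toBTree_eq_attach_oddCarets (t : BTree) :
    (∃ T : QTree, T.toBTree = t.attach (oddCarets (t.parities true))) ∧
      ∃ T T' : QTree,
        .node T.toBTree T'.toBTree = t.attach (oddCarets (t.parities false)) := by
  induction t with
  | leaf => exact ⟨⟨.leaf, rfl⟩, .leaf, .leaf, rfl⟩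
  | node l r hl hr =>
    have e : ∀ b, (node l r).attach (oddCarets ((node l r).parities b)) =
        node (l.attach (oddCarets (l.parities !b))) (r.attach (oddCarets (r.parities !b))) := by
      intro b
      have h : l.leaves = (oddCarets (l.parities !b)).length := by
        simp [oddCarets, length_parities]
      rw [attach, parities, oddCarets, List.map_append]
      change node (l.attach ((oddCarets _ ++ oddCarets _).take _))
        (r.attach ((oddCarets _ ++ oddCarets _).drop _)) = _
      rw [h, List.take_left, List.drop_left]
    rw [e, e]
    obtain ⟨⟨A, hA⟩, B, B', hB⟩ := hl
    obtain ⟨⟨C, hC⟩, D, D', hD⟩ := hr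
    refine ⟨⟨.node B B' D D', ?_⟩, A, C, ?_⟩
    · rw [QTree.toBTree, hB, hD]; rfl
    · rw [hA, hC]; rfl

theorem IsTreePair.attach {g : unitInterval ≃ₜ unitInterval} {s t : BTree} (h : IsTreePair g s t)
    {fs : List BTree} (hf : fs.length = t.leaves) : IsTreePair g (s.attach fs) (t.attach fs) := by
  have := h.refine (le_attach t fs)
  rwa [forest_attach _ _ hf] at this

/-- The elements of the 3-colorable subgroup are those represented by pairs of four-ary trees. -/
theorem mem_threeColorable_iff_exists {g : thompsonF} :
    g ∈ threeColorable ↔ ∃ S T : QTree,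
      IsTreePair (g : unitInterval ≃ₜ unitInterval) S.toBTree T.toBTree := by
  constructor
  · intro hg
    obtain ⟨s, t, h⟩ := g.2
    have e := (mem_threeColorable_iff h).1 hg
    obtain ⟨S, hS⟩ := (exists_toBTree_eq_attach_oddCarets s).1
    obtain ⟨T, hT⟩ := (exists_toBTree_eq_attach_oddCarets t).1
    refine ⟨S, T, ?_⟩
    rw [hS, hT, e]
    exact h.attach (by simp [oddCarets, length_parities])
  · rintro ⟨S, T, h⟩
    have e := h.leaves_eq
    rw [QTree.leaves_toBTree, QTree.leaves_toBTree] at e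
    rw [mem_threeColorable_iff h, QTree.parities_toBTree, QTree.parities_toBTree, e]

/-! ### Pairs of four-ary trees -/

/-- The pair of four-ary trees `(S, T)` represents the element `g`. -/
def IsQTreePair (g : threeColorable) (S T : QTree) : Prop :=
  IsTreePair ((g : thompsonF) : unitInterval ≃ₜ unitInterval) S.toBTree T.toBTree

theorem exists_isQTreePair {S T : QTree} (h : S.leaves = T.leaves) :
    ∃ g, IsQTreePair g S T := by
  rw [← S.leaves_toBTree, ← T.leaves_toBTree] at h
  obtain ⟨g, hg⟩ := exists_isTreePair h
  exact ⟨⟨g, mem_threeColorable_iff_exists.2 ⟨S, T, hg⟩⟩, hg⟩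

namespace IsQTreePair

variable {g h : threeColorable} {R S T : QTree}

theorem ext (hg : IsQTreePair g S T) (hh : IsQTreePair h S T) : g = h :=
  Subtype.ext (Subtype.ext (IsTreePair.ext hg hh))

theorem mul (hg : IsQTreePair g R S) (hh : IsQTreePair h S T) : IsQTreePair (g * h) R T :=
  IsTreePair.mul hg hh

theorem inv (hg : IsQTreePair g S T) : IsQTreePair g⁻¹ T S :=
  IsTreePair.inv hg

theorem unique (hg : IsQTreePair g R T) (hg' : IsQTreePair g S T) : R = S :=
  QTree.toBTree_injective (IsTreePair.unique hg hg')

theorem leaves_eq (hg : IsQTreePair g S T) : S.leaves = T.leaves := by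
  rw [← S.leaves_toBTree, ← T.leaves_toBTree]
  exact IsTreePair.leaves_eq hg

theorem addCaret (hg : IsQTreePair g S T) {k : ℕ} (hk : k < T.leaves) :
    IsQTreePair g (S.addCaret k) (T.addCaret k) := by
  have h := IsTreePair.leaves_eq hg
  rw [IsQTreePair, S.toBTree_addCaret (hg.leaves_eq ▸ hk), T.toBTree_addCaret hk, h]
  exact IsTreePair.attach hg (by simp)

end IsQTreePair

theorem isQTreePair_one (T : QTree) : IsQTreePair 1 T T := isTreePair_one T.toBTree

namespace QTree

/-- The tree with `m` vertices, each of which, but the first, is the last child of another one. -/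
def vine : ℕ → QTree
  | 0 => leaf
  | m + 1 => node leaf leaf leaf (vine m)

theorem leaves_vine (m : ℕ) : (vine m).leaves = 3 * m + 1 := by
  induction m with
  | zero => rfl
  | succ m ih => simp only [vine, leaves, ih]; omega

theorem vine_addCaret_last (m : ℕ) : (vine m).addCaret (3 * m) = vine (m + 1) := by
  induction m with
  | zero => rfl
  | succ m ih =>
    rw [vine, show 3 * (m + 1) = leaf.leaves + leaf.leaves + leaf.leaves + 3 * m by
      simp only [leaves]; omega, addCaret_fourth, ih]
    rfl

theorem vine_addCaret_addCaret {m k : ℕ} (hk : k < 3 * m) :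
    ((vine m).addCaret k).addCaret (3 * m + 3) = (vine (m + 1)).addCaret k := by
  rw [← addCaret_comm _ hk (by rw [leaves_vine]; omega), vine_addCaret_last]

end QTree

open QTree

/-! ### The generators -/

theorem leaves_vine_addCaret (m k : ℕ) : ((vine m).addCaret k).leaves = (vine (m + 1)).leaves := by
  rw [leaves_addCaret, leaves_vine, leaves_vine]
  ring

/-- The element that corresponds to the generator `x_k`: it is represented by a vine with one more
caret, on the leaf `k`, and a vine. -/
noncomputable def generator (k : ℕ) : threeColorable :=
  (exists_isQTreePair (leaves_vine_addCaret (k / 3 + 1) k)).choose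

/-- The vine may have any length, provided that the leaf `k` is not the last one. -/
theorem isQTreePair_generator {k m : ℕ} (h : k < 3 * m) :
    IsQTreePair (generator k) ((vine m).addCaret k) (vine (m + 1)) := by
  have hm : k / 3 + 1 ≤ m := by omega
  clear h
  induction m, hm using Nat.le_induction with
  | base => exact (exists_isQTreePair (leaves_vine_addCaret (k / 3 + 1) k)).choose_spec
  | succ m hm ih =>
    have := ih.addCaret (k := 3 * (m + 1)) (by rw [leaves_vine]; omega)
    rwa [vine_addCaret_last, mul_add, mul_one, vine_addCaret_addCaret (by omega)] at this

theorem generator_mul_generator {k n : ℕ} (h : k < n) :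
    generator n * generator k = generator k * generator (n + 3) := by
  have hm : n < 3 * (n + 1) := by omega
  have h1 := (isQTreePair_generator hm).addCaret (k := k) (by rw [leaves_vine]; omega)
  have h2 := isQTreePair_generator (k := k) (m := n + 1 + 1) (by omega)
  have h3 := (isQTreePair_generator (h.trans hm)).addCaret (k := n + 3) (by rw [leaves_vine]; omega)
  have h4 := isQTreePair_generator (k := n + 3) (m := n + 1 + 1) (by omega)
  rw [addCaret_comm _ h (by rw [leaves_vine]; omega)] at h1
  exact (h1.mul h2).ext (h3.mul h4)

/-- The generator `x_k` of the presented group. -/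
def gen (k : ℕ) : ThompsonGroup 4 := PresentedGroup.of k

theorem gen_mul_gen {k n : ℕ} (h : k < n) : gen n * gen k = gen k * gen (n + 3) := by
  have : (gen k)⁻¹ * gen n * gen k * (gen (n + 3))⁻¹ = 1 :=
    PresentedGroup.one_of_mem ⟨k, n, h, rfl⟩
  rw [mul_inv_eq_one, mul_assoc, inv_mul_eq_iff_eq_mul] at this
  exact this

/-- The map of the presented group to the 3-colorable subgroup. -/
noncomputable def toThreeColorable : ThompsonGroup 4 →* threeColorable :=
  PresentedGroup.toGroup (f := generator) (by
    rintro _ ⟨k, n, h, rfl⟩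
    simp only [map_mul, map_inv, FreeGroup.lift_apply_of]
    rw [mul_inv_eq_one, mul_assoc, inv_mul_eq_iff_eq_mul]
    exact generator_mul_generator h)

theorem toThreeColorable_gen (k : ℕ) : toThreeColorable (gen k) = generator k :=
  PresentedGroup.toGroup.of _

/-! ### Trees as elements of the presented group -/

/-- The product of generators that builds the tree on the leaf `k`, which is not the last one. -/
def QTree.word : QTree → ℕ → ThompsonGroup 4
  | leaf, _ => 1
  | node a b c d, k => gen k * d.word (k + 3) * c.word (k + 2) * b.word (k + 1) * a.word k

/-- The product of generators that builds the tree on the leaf `k`, which is the last one: the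
vertices on the right edge of the tree are not counted. -/
def QTree.lastWord : QTree → ℕ → ThompsonGroup 4
  | leaf, _ => 1
  | node a b c d, k => d.lastWord (k + 3) * c.word (k + 2) * b.word (k + 1) * a.word k

theorem gen_mul_word (T : QTree) (k i : ℕ) :
    gen (k + 1 + i) * T.word k = T.word k * gen (k + T.leaves + i) := by
  induction T generalizing k i with
  | leaf => simp [word, QTree.leaves]
  | node a b c d ha hb hc hd =>
    have h0 : gen (k + 1 + i) * gen k = gen k * gen (k + 3 + 1 + i) := by
      rw [gen_mul_gen (by omega)]
      congr 2
      omega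
    have h1 := hd (k + 3) i
    have h2 := hc (k + 2) (d.leaves + i)
    have h3 := hb (k + 1) (c.leaves + d.leaves + i)
    have h4 := ha k (b.leaves + c.leaves + d.leaves + i)
    rw [show k + 2 + 1 + (d.leaves + i) = k + 3 + d.leaves + i by ring] at h2
    rw [show k + 1 + 1 + (c.leaves + d.leaves + i) = k + 2 + c.leaves + (d.leaves + i) by ring] at h3
    rw [show k + 1 + (b.leaves + c.leaves + d.leaves + i) =
      k + 1 + b.leaves + (c.leaves + d.leaves + i) by ring] at h4
    rw [word, ← mul_assoc, ← mul_assoc, ← mul_assoc, ← mul_assoc, h0, mul_assoc (gen k), h1,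
      ← mul_assoc, mul_assoc _ _ (c.word _), h2, ← mul_assoc, mul_assoc _ _ (b.word _), h3,
      ← mul_assoc, mul_assoc _ _ (a.word _), h4, ← mul_assoc]
    congr 2
    simp only [QTree.leaves]
    ring

/-- A generator that adds a caret to a child of a vertex passes the words of the children on the left
of it. -/
theorem gen_mul_word_mul_word (b c : QTree) (k i : ℕ) :
    gen (k + 2 + i) * b.word (k + 1) * c.word k =
      b.word (k + 1) * c.word k * gen (k + (c.leaves + b.leaves + i)) := by
  have h1 := gen_mul_word b (k + 1) i
  have h2 := gen_mul_word c k (b.leaves + i)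
  rw [show k + 1 + (b.leaves + i) = k + 1 + b.leaves + i by ring] at h2
  rw [show k + 2 + i = k + 1 + 1 + i by ring, h1, mul_assoc, h2, ← mul_assoc]
  congr 2
  ring

theorem gen_mul_word_mul_word_mul_word (a b c : QTree) (k i : ℕ) :
    gen (k + 3 + i) * c.word (k + 2) * b.word (k + 1) * a.word k =
      c.word (k + 2) * b.word (k + 1) * a.word k *
        gen (k + (a.leaves + b.leaves + c.leaves + i)) := by
  have h1 := gen_mul_word_mul_word c b (k + 1) i
  have h2 := gen_mul_word a k (b.leaves + c.leaves + i)
  rw [show k + 1 + 2 + i = k + 3 + i by ring, show k + 1 + 1 = k + 2 by ring] at h1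
  rw [h1, mul_assoc, h2, ← mul_assoc]
  congr 2
  ring

theorem word_addCaret (T : QTree) {j : ℕ} (hj : j < T.leaves) (k : ℕ) :
    (T.addCaret j).word k = T.word k * gen (k + j) := by
  induction T generalizing j k with
  | leaf =>
    obtain rfl : j = 0 := by simpa [QTree.leaves] using hj
    simp [addCaret, word]
  | node a b c d ha hb hc hd =>
    rcases exists_child hj with h | ⟨i, h, rfl⟩ | ⟨i, h, rfl⟩ | ⟨i, h, rfl⟩
    · rw [addCaret_first h, word, ha h, word, ← mul_assoc]
    · have := gen_mul_word a k i
      rw [addCaret_second h, word, hb h, word, ← mul_assoc, mul_assoc _ _ (a.word k), this,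
        ← mul_assoc, add_assoc]
    · have := gen_mul_word_mul_word b a k i
      rw [addCaret_third h, word, hc h, word]
      simp only [mul_assoc] at this ⊢
      rw [this]
    · have := gen_mul_word_mul_word_mul_word a b c k i
      rw [addCaret_fourth, word, hd h, word]
      simp only [mul_assoc] at this ⊢
      rw [this]

theorem lastWord_addCaret (T : QTree) {j : ℕ} (hj : j + 1 < T.leaves) (k : ℕ) :
    (T.addCaret j).lastWord k = T.lastWord k * gen (k + j) := by
  induction T generalizing j k with
  | leaf => simp [QTree.leaves] at hj
  | node a b c d ha hb hc hd =>
    rcases exists_child (Nat.lt_of_succ_lt hj) with h | ⟨i, h, rfl⟩ | ⟨i, h, rfl⟩ | ⟨i, h, rfl⟩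
    · rw [addCaret_first h, lastWord, word_addCaret a h, lastWord, ← mul_assoc]
    · have := gen_mul_word a k i
      rw [addCaret_second h, lastWord, word_addCaret b h, lastWord, ← mul_assoc,
        mul_assoc _ _ (a.word k), this, ← mul_assoc, add_assoc]
    · have := gen_mul_word_mul_word b a k i
      rw [addCaret_third h, lastWord, word_addCaret c h, lastWord]
      simp only [mul_assoc] at this ⊢
      rw [this]
    · have := gen_mul_word_mul_word_mul_word a b c k i
      rw [addCaret_fourth, lastWord, hd (by simp only [QTree.leaves] at hj; omega), lastWord]
      simp only [mul_assoc] at this ⊢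
      rw [this]

theorem lastWord_addCaret_last (T : QTree) {j : ℕ} (hj : j + 1 = T.leaves) (k : ℕ) :
    (T.addCaret j).lastWord k = T.lastWord k := by
  induction T generalizing j k with
  | leaf => simp [addCaret, lastWord, word]
  | node a b c d ha hb hc hd =>
    have hd0 := d.leaves_pos
    simp only [QTree.leaves] at hj
    obtain ⟨i, rfl⟩ : ∃ i, j = a.leaves + b.leaves + c.leaves + i :=
      ⟨j - (a.leaves + b.leaves + c.leaves), by omega⟩
    rw [addCaret_fourth, lastWord, hd (by omega), lastWord]

theorem lastWord_vine (m k : ℕ) : (vine m).lastWord k = 1 := by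
  induction m generalizing k with
  | zero => rfl
  | succ m ih => simp [vine, lastWord, word, ih]

/-- A tree and the vine with as many leaves represent the image of the word of the tree. -/
theorem exists_isQTreePair_lastWord (T : QTree) :
    ∃ m, IsQTreePair (toThreeColorable (T.lastWord 0)) T (vine m) := by
  induction T using addCaret_induction with
  | h1 => exact ⟨0, by rw [lastWord, map_one]; exact isQTreePair_one _⟩
  | h2 T k hk ih =>
    obtain ⟨m, h⟩ := ih
    have hT := h.leaves_eq
    have hc := h.addCaret (hT ▸ hk)
    rw [leaves_vine] at hT
    refine ⟨m + 1, ?_⟩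
    rcases (show k ≤ 3 * m by omega).lt_or_eq with hlt | rfl
    · rw [lastWord_addCaret T (by omega), map_mul, zero_add, toThreeColorable_gen]
      exact hc.mul (isQTreePair_generator hlt)
    · rw [lastWord_addCaret_last T hT.symm]
      rwa [vine_addCaret_last] at hc

theorem isQTreePair_lastWord {T : QTree} {m : ℕ} (h : T.leaves = 3 * m + 1) :
    IsQTreePair (toThreeColorable (T.lastWord 0)) T (vine m) := by
  obtain ⟨n, hn⟩ := exists_isQTreePair_lastWord T
  have := hn.leaves_eq
  rw [leaves_vine] at this
  obtain rfl : n = m := by omega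
  exact hn

theorem toThreeColorable_surjective : Function.Surjective toThreeColorable := by
  intro g
  obtain ⟨S, T, h⟩ := mem_threeColorable_iff_exists.1 g.2
  change IsQTreePair g S T at h
  obtain ⟨m, hT⟩ := exists_isQTreePair_lastWord T
  have hS := isQTreePair_lastWord (h.leaves_eq.trans (hT.leaves_eq.trans (leaves_vine m)))
  refine ⟨S.lastWord 0 * (T.lastWord 0)⁻¹, ?_⟩
  rw [map_mul, map_inv]
  exact (hS.mul hT.inv).ext h

/-! ### Fractions -/

/-- A product of generators. -/
def genProd (p : List ℕ) : ThompsonGroup 4 := (p.map gen).prod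

theorem genProd_cons (k : ℕ) (p : List ℕ) : genProd (k :: p) = gen k * genProd p := by
  simp [genProd]

theorem genProd_append (p q : List ℕ) : genProd (p ++ q) = genProd p * genProd q := by
  simp [genProd]

theorem inv_gen_mul_genProd (p : List ℕ) (k : ℕ) :
    ∃ p' q', (gen k)⁻¹ * genProd p = genProd p' * (genProd q')⁻¹ := by
  induction p generalizing k with
  | nil => exact ⟨[], [k], by simp [genProd]⟩
  | cons n p ih =>
    rcases lt_trichotomy k n with h | rfl | h
    · obtain ⟨p', q', e⟩ := ih k
      refine ⟨(n + 3) :: p', q', ?_⟩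
      have : (gen k)⁻¹ * gen n = gen (n + 3) * (gen k)⁻¹ := by
        rw [inv_mul_eq_iff_eq_mul, ← mul_assoc, eq_mul_inv_iff_mul_eq, gen_mul_gen h]
      rw [genProd_cons, genProd_cons, ← mul_assoc, this, mul_assoc, e, mul_assoc]
    · exact ⟨p, [], by simp [genProd]⟩
    · obtain ⟨p', q', e⟩ := ih (k + 3)
      refine ⟨n :: p', q', ?_⟩
      have : (gen k)⁻¹ * gen n = gen n * (gen (k + 3))⁻¹ := by
        rw [inv_mul_eq_iff_eq_mul, ← mul_assoc, eq_mul_inv_iff_mul_eq, gen_mul_gen h]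
      rw [genProd_cons, genProd_cons, ← mul_assoc, this, mul_assoc, e, mul_assoc]

/-- Every element of the presented group is a fraction of positive words. -/
theorem exists_genProd_mul_inv (z : ThompsonGroup 4) :
    ∃ p q, z = genProd p * (genProd q)⁻¹ := by
  have hz : z ∈ Subgroup.closure (Set.range gen) := by
    have := PresentedGroup.closure_range_of {w : FreeGroup ℕ | ∃ k n, k < n ∧
      w = (FreeGroup.of k)⁻¹ * FreeGroup.of n * FreeGroup.of k * (FreeGroup.of (n + (4 - 1)))⁻¹}
    exact this ▸ Subgroup.mem_top z
  induction hz using Subgroup.closure_induction_left with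
  | one => exact ⟨[], [], by simp [genProd]⟩
  | mul_left x hx y _ ih =>
    obtain ⟨k, rfl⟩ := hx
    obtain ⟨p, q, rfl⟩ := ih
    exact ⟨k :: p, q, by rw [genProd_cons, mul_assoc]⟩
  | inv_mul_cancel x hx y _ ih =>
    obtain ⟨k, rfl⟩ := hx
    obtain ⟨p, q, rfl⟩ := ih
    obtain ⟨p', q', e⟩ := inv_gen_mul_genProd p k
    exact ⟨p', q ++ q', by rw [← mul_assoc, e, genProd_append, mul_inv_rev, mul_assoc]⟩

theorem exists_lastWord_eq (p : List ℕ) (T : QTree) (h : ∀ k ∈ p, k + 1 < T.leaves) :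
    ∃ S : QTree, S.leaves = T.leaves + 3 * p.length ∧
      S.lastWord 0 = T.lastWord 0 * genProd p := by
  induction p generalizing T with
  | nil => exact ⟨T, by simp, by simp [genProd]⟩
  | cons k p ih =>
    obtain ⟨S, h1, h2⟩ := ih (T.addCaret k) fun n hn => by
      rw [leaves_addCaret]
      exact (h n (by simp [hn])).trans_le (Nat.le_add_right _ _)
    refine ⟨S, ?_, ?_⟩
    · rw [h1, leaves_addCaret, List.length_cons]
      ring
    · rw [h2, lastWord_addCaret T (h k (by simp)), zero_add, genProd_cons, mul_assoc]

/-- Every element of the presented group comes from a pair of trees. -/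
theorem exists_lastWord_mul_inv (z : ThompsonGroup 4) :
    ∃ S T : QTree, ∃ m, S.leaves = 3 * m + 1 ∧ T.leaves = 3 * m + 1 ∧
      z = S.lastWord 0 * (T.lastWord 0)⁻¹ := by
  obtain ⟨p, q, rfl⟩ := exists_genProd_mul_inv z
  obtain ⟨N, hN⟩ := (p ++ q).toFinset.exists_nat_subset_range
  have hN' : ∀ k, k ∈ p ∨ k ∈ q → k < N := fun k hk =>
    Finset.mem_range.1 (hN (by simpa using hk))
  -- The lengths of the two vines are such that the two trees have the same number of leaves.
  obtain ⟨S, hS, eS⟩ := exists_lastWord_eq p (vine (N + q.length)) fun k hk => by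
    have := hN' k (.inl hk)
    rw [leaves_vine]
    omega
  obtain ⟨T, hT, eT⟩ := exists_lastWord_eq q (vine (N + p.length)) fun k hk => by
    have := hN' k (.inr hk)
    rw [leaves_vine]
    omega
  rw [leaves_vine] at hS hT
  refine ⟨S, T, N + p.length + q.length, by omega, by omega, ?_⟩
  rw [eS, eT, lastWord_vine, lastWord_vine, one_mul, one_mul]

theorem toThreeColorable_injective : Function.Injective toThreeColorable := by
  refine (injective_iff_map_eq_one _).2 fun z hz => ?_
  obtain ⟨S, T, m, hS, hT, rfl⟩ := exists_lastWord_mul_inv z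
  rw [map_mul, map_inv, mul_inv_eq_one] at hz
  have h := isQTreePair_lastWord hS
  rw [hz] at h
  rw [h.unique (isQTreePair_lastWord hT), mul_inv_cancel]

end ThreeColor

theorem mainTheorem2 :
    Nonempty (ThreeColor.threeColorable ≃* ThreeColor.ThompsonGroup 4) ∧
    (∀ (g : ThreeColor.thompsonF) (Tp Tm : ThreeColor.BTree),
      ThreeColor.IsTreePair (g : unitInterval ≃ₜ unitInterval) Tp Tm →
        (g ∈ ThreeColor.threeColorable ↔ (ThreeColor.dualGraph Tp Tm).Colorable 3)) ∧
    (∀ g : ThreeColor.thompsonF,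
      g ∈ ThreeColor.threeColorable ↔
        ∃ Tp Tm : ThreeColor.BTree,
          ThreeColor.IsTreePair (g : unitInterval ≃ₜ unitInterval) Tp Tm ∧
            ThreeColor.Alg ThreeColor.treeX Tp ∧ ThreeColor.Alg ThreeColor.treeX Tm) := by
  refine ⟨⟨(MulEquiv.ofBijective ThreeColor.toThreeColorable
    ⟨ThreeColor.toThreeColorable_injective, ThreeColor.toThreeColorable_surjective⟩).symm⟩, ?_, ?_⟩
  · intro g Tp Tm h
    rw [ThreeColor.mem_threeColorable_iff h, ThreeColor.dualGraph_colorable_iff h.leaves_eq]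
  · intro g
    rw [ThreeColor.mem_threeColorable_iff_exists]
    constructor
    · rintro ⟨S, T, h⟩
      exact ⟨_, _, h, ThreeColor.alg_treeX_iff.2 ⟨S, rfl⟩, ThreeColor.alg_treeX_iff.2 ⟨T, rfl⟩⟩
    · rintro ⟨Tp, Tm, h, hp, hm⟩
      obtain ⟨S, rfl⟩ := ThreeColor.alg_treeX_iff.1 hp
      obtain ⟨T, rfl⟩ := ThreeColor.alg_treeX_iff.1 hm
      exact ⟨S, T, h⟩
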